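/- Let $G$ be a compact Lie group with Lie algebra $\mathfrak g$, and let $N$ be a smooth (Hausdorff, second-countable) manifold, possibly with boundary, with a smooth $G$-action. For $X\in\mathfrak g$ let $X^\sharp$ be the vector field $X^\sharp|_x=\frac{d}{dt}\big|_{t=0}\exp(tX)\cdot x$ on $N$. Let $v\colon N\to\mathfrak g$ be a taming map, i.e. a smooth map that is equivariant for the adjoint action; let $v^\sharp|_x=v(x)^\sharp|_x$ be the associated vector field and $Z=\{v^\sharp=0\}$ the localizing set. A map $\Phi\colon N\to\mathfrak g^*$ (or its restriction to a subset $Y$) is called $v$-polarized if the function $\Phi^v=\langle\Phi,v\rangle$ is proper and bounded from below on $N$ (respectively on $Y$). A momentum map for a $G$-invariant closed 2-form $\omega$ is a smooth $G$-equivariant map $\Phi\colon N\to\mathfrak g^*$ with $d\langle\Phi,X\rangle=\iota(X^\sharp)\omega$ for all $X\in\mathfrak g$; $\omega$ is allowed to be degenerate. Let $Y$ be a closed $G$-invariant subset of $N$ that contains $Z$. Let $\omega$ be a $G$-invariant closed $2$-form on $N$ and $\Phi$ a corresponding momentum map, and suppose that the restriction of $\Phi$ to $Y$ is $v$-polarized.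 Then there exist a $G$-invariant closed $2$-form $\widetilde\omega$ on $N$ and a corresponding momentum map $\widetilde\Phi$ that coincide with $\omega$ and $\Phi$ on a $G$-invariant open neighbourhood $U$ of $Y$ and such that $\widetilde\Phi$ is $v$-polarized on $N$. Moreover, the pair can be taken of the form $$\widetilde\omega=\omega-d\big((\psi-\Phi^v)\Theta\big),\qquad \langle\widetilde\Phi,X\rangle=\langle\Phi,X\rangle+(\psi-\Phi^v)\,\Theta(X^\sharp)\quad(X\in\mathfrak g),$$ where $\psi\colon N\to\mathbb R$ is a smooth $G$-invariant function that is proper, bounded from below and equal to $\Phi^v$ on $U$, where $\Theta=g(\cdot,v^\sharp)/g(v^\sharp,v^\sharp)$ on $N\smallsetminus Z$ for some $G$-invariant Riemannian metric $g$ on $N$, and where $(\psi-\Phi^v)\Theta$ is extended by $0$ to $Z$. -/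

import Mathlib

open Set Topology
open scoped Manifold ContDiff Bundle

noncomputable section

namespace HamiltonianCompletion

/-! ### Differential forms on a manifold, possibly with boundary -/

section Forms

variable {E : Type*} [NormedAddCommGroup E] [NormedSpace ℝ E]
  {H : Type*} [TopologicalSpace H] (I : ModelWithCorners ℝ E H)
  {N : Type*} [TopologicalSpace N] [ChartedSpace H N]

/-- The expression of a `k`-form `σ` in the chart around `x₀`: the pullback of `σ` under the
inverse of the chart. It is meaningful on the target of the chart. -/
def formInChart {k : ℕ} (σ : (x : N) → TangentSpace I x [⋀^Fin k]→L[ℝ] ℝ) (x₀ : N) (y : E) :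
    E [⋀^Fin k]→L[ℝ] ℝ :=
  (σ ((extChartAt I x₀).symm y)).compContinuousLinearMap
    (mfderivWithin 𝓘(ℝ, E) I (extChartAt I x₀).symm (range I) y)

/-- A `k`-form is smooth if all its expressions in charts are. -/
def IsSmoothForm {k : ℕ} (σ : (x : N) → TangentSpace I x [⋀^Fin k]→L[ℝ] ℝ) : Prop :=
  ∀ x₀ : N, ContDiffOn ℝ ∞ (formInChart I σ x₀) (extChartAt I x₀).target

/-- The exterior derivative `dσ` of a `k`-form `σ`; at the point `x` it is computed in the chart
around `x` and pulled back to the tangent space at `x`. -/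
def exteriorDerivative {k : ℕ} (σ : (x : N) → TangentSpace I x [⋀^Fin k]→L[ℝ] ℝ) (x : N) :
    TangentSpace I x [⋀^Fin (k + 1)]→L[ℝ] ℝ :=
  (extDerivWithin (formInChart I σ x) (range I) (extChartAt I x x)).compContinuousLinearMap
    (mfderiv I 𝓘(ℝ, E) (extChartAt I x) x)

/-- A `1`-form given as a family of linear functionals, seen as an alternating form. -/
def oneForm (β : (x : N) → TangentSpace I x →L[ℝ] ℝ) (x : N) :
    TangentSpace I x [⋀^Fin 1]→L[ℝ] ℝ :=
  ContinuousAlternatingMap.ofSubsingleton ℝ (TangentSpace I x) ℝ (0 : Fin 1) (β x)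

end Forms

/-! ### Actions of Lie groups, taming maps, momentum maps -/

section Actions

variable {EG : Type*} [NormedAddCommGroup EG] [NormedSpace ℝ EG]
  {HG : Type*} [TopologicalSpace HG] (IG : ModelWithCorners ℝ EG HG)
  {G : Type*} [TopologicalSpace G] [ChartedSpace HG G] [Group G]
  {E : Type*} [NormedAddCommGroup E] [NormedSpace ℝ E]
  {H : Type*} [TopologicalSpace H] (I : ModelWithCorners ℝ E H)
  {N : Type*} [TopologicalSpace N] [ChartedSpace H N] [MulAction G N]

/-- The adjoint action `Ad_g` on the Lie algebra: the differential at `1` of `h ↦ g h g⁻¹`.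
(The point `g * 1 * g⁻¹` is `1`.) -/
def adjoint (g : G) (X : GroupLieAlgebra IG G) : GroupLieAlgebra IG G :=
  mfderiv IG IG (fun h : G => g * h * g⁻¹) 1 X

/-- The fundamental vector field `X^♯` of `X ∈ 𝔤`, with the sign convention
`X^♯|_x = d/dt|_{t=0} (exp (tX) • x)`: the image of `X` under the differential at `1` of the orbit
map `g ↦ g • x`. (The point `1 • x` is `x`.) -/
def fundamentalField (X : GroupLieAlgebra IG G) (x : N) : TangentSpace I x :=
  mfderiv IG I (fun g : G => g • x) 1 X

/-- A subset that is stable under the action of `G`. -/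
def IsInvariantSet (G : Type*) [Group G] {N : Type*} [MulAction G N] (Y : Set N) : Prop :=
  ∀ g : G, ∀ x ∈ Y, g • x ∈ Y

/-- A `k`-form with `g^* σ = σ` for all `g ∈ G`. -/
def IsInvariantForm (G : Type*) [Group G] [MulAction G N] {k : ℕ}
    (σ : (x : N) → TangentSpace I x [⋀^Fin k]→L[ℝ] ℝ) : Prop :=
  ∀ (g : G) (x : N), (σ (g • x)).compContinuousLinearMap (mfderiv I I (fun y : N => g • y) x) = σ x

/-- A taming map: a smooth equivariant function `v : N → 𝔤`. -/
structure IsTamingMap (v : N → GroupLieAlgebra IG G) : Prop where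
  smooth : ContMDiff (M' := EG) I 𝓘(ℝ, EG) ∞ v
  equivariant : ∀ (g : G) (x : N), v (g • x) = adjoint IG g (v x)

/-- The vector field `v^♯|_x = (v x)^♯|_x` of `v : N → 𝔤`. -/
def tamingField (v : N → GroupLieAlgebra IG G) (x : N) : TangentSpace I x :=
  fundamentalField IG I (v x) x

/-- The localizing set `Z = {v^♯ = 0}`. -/
def localizingSet (v : N → GroupLieAlgebra IG G) : Set N :=
  {x | tamingField IG I v x = 0}

/-- The restriction of `Φ : N → 𝔤^*` to `Y` is `v`-polarized: the function `Φ^v = ⟨Φ, v⟩` on `Y`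
is proper and bounded from below. -/
def IsPolarizedOn {N : Type*} [TopologicalSpace N] (v : N → GroupLieAlgebra IG G)
    (Φ : N → (GroupLieAlgebra IG G →L[ℝ] ℝ)) (Y : Set N) : Prop :=
  IsProperMap (fun y : Y => Φ y (v y)) ∧ BddBelow (range fun y : Y => Φ y (v y))

/-- `σ` is an invariant closed (smooth) `2`-form on `N`, and `Φ : N → 𝔤^*` is a corresponding
momentum map: it is smooth, equivariant for the coadjoint action, and satisfies Hamilton's
equation `dΦ^X = ι(X^♯) σ` for all `X ∈ 𝔤`, where `Φ^X = ⟨Φ, X⟩`. -/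
structure IsHamiltonian (σ : (x : N) → TangentSpace I x [⋀^Fin 2]→L[ℝ] ℝ)
    (Φ : N → (GroupLieAlgebra IG G →L[ℝ] ℝ)) : Prop where
  smooth_form : IsSmoothForm I σ
  invariant : IsInvariantForm I G σ
  closed : ∀ x, exteriorDerivative I σ x = 0
  smooth_map : ∀ X : GroupLieAlgebra IG G, ContMDiff I 𝓘(ℝ, ℝ) ∞ (fun x => Φ x X)
  equivariant : ∀ (g : G) (x : N) (X : GroupLieAlgebra IG G),
    Φ (g • x) X = Φ x (adjoint IG g⁻¹ X)
  hamilton : ∀ (X : GroupLieAlgebra IG G) (x : N) (u : TangentSpace I x),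
    mfderiv I 𝓘(ℝ, ℝ) (fun y => Φ y X) x u = σ x ![fundamentalField IG I X x, u]

end Actions

/-! ### Invariant Riemannian metrics and Bott projectors -/

section Bott

variable {E : Type*} [NormedAddCommGroup E] [NormedSpace ℝ E]
  {H : Type*} [TopologicalSpace H] (I : ModelWithCorners ℝ E H)
  {N : Type*} [TopologicalSpace N] [ChartedSpace H N] [IsManifold I ∞ N]

/-- A smooth Riemannian metric for which `G` acts by isometries. -/
def IsInvariantMetric (G : Type*) [Group G] [MulAction G N]
    (m : Bundle.ContMDiffRiemannianMetric I ∞ E (TangentSpace I : N → Type _)) : Prop :=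
  ∀ (g : G) (x : N) (u w : TangentSpace I x),
    m.inner (g • x) (mfderiv I I (fun y : N => g • y) x u) (mfderiv I I (fun y : N => g • y) x w)
      = m.inner x u w

/-- The Bott projector `Θ = m(·, V) / m(V, V)` of a vector field `V` and a metric `m`, a `1`-form
on the set where `V ≠ 0`. On the zeros of `V` the formula returns the value `0`. -/
def bottProjector (m : Bundle.ContMDiffRiemannianMetric I ∞ E (TangentSpace I : N → Type _))
    (V : (x : N) → TangentSpace I x) (x : N) : TangentSpace I x →L[ℝ] ℝ :=
  (m.inner x (V x) (V x))⁻¹ • m.inner x (V x)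

end Bott

end HamiltonianCompletion

end

noncomputable section

namespace HamiltonianCompletion

/-! ### Smoothness of integrals over a compact group -/

section ParametricIntegral

open MeasureTheory

lemma eventually_forall_norm_sub_lt {X G V : Type*} [TopologicalSpace X] [TopologicalSpace G]
    [CompactSpace G] [NormedAddCommGroup V] {F : X → G → V} {S : Set X}
    (hF : ContinuousOn (Function.uncurry F) (S ×ˢ univ)) {x : X} (hx : x ∈ S) {ε : ℝ}
    (hε : 0 < ε) : ∀ᶠ y in 𝓝[S] x, ∀ g, ‖F y g - F x g‖ < ε := by
  have key : ∀ᶠ y in 𝓝 x, ∀ g ∈ (univ : Set G), y ∈ S → ‖F y g - F x g‖ < ε := by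
    refine isCompact_univ.eventually_forall_of_forall_eventually fun g _ => ?_
    have hc : ContinuousOn (fun z : X × G => ‖F z.1 z.2 - F x z.2‖) (S ×ˢ univ) := by
      refine (hF.sub ?_).norm
      exact hF.comp (f := fun z : X × G => (x, z.2)) (by fun_prop) (fun z _ => ⟨hx, mem_univ _⟩)
    have hlt : ‖F (x, g).1 (x, g).2 - F x (x, g).2‖ < ε := by simpa using hε
    have h0 := (hc (x, g) ⟨hx, mem_univ _⟩).eventually (gt_mem_nhds hlt)
    rw [eventually_nhdsWithin_iff] at h0
    exact h0.mono fun z hz hzS => hz ⟨hzS, mem_univ _⟩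
  rw [eventually_nhdsWithin_iff]
  exact key.mono fun y hy hyS g => hy g (mem_univ g) hyS

variable {E V G : Type*} [NormedAddCommGroup E] [NormedSpace ℝ E]
  [NormedAddCommGroup V] [NormedSpace ℝ V]
  [TopologicalSpace G] [CompactSpace G] [MeasurableSpace G] [BorelSpace G]
  (μ : Measure G) [IsProbabilityMeasure μ]

omit [NormedSpace ℝ V] in
lemma integrable_of_continuous {f : G → V} (hf : Continuous f) : Integrable f μ :=
  hf.integrable_of_hasCompactSupport (HasCompactSupport.of_compactSpace f)

omit [TopologicalSpace G] [CompactSpace G] [BorelSpace G] in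
lemma norm_integral_le_of_forall_norm_le {f : G → V} {C : ℝ} (h : ∀ g, ‖f g‖ ≤ C) :
    ‖∫ g, f g ∂μ‖ ≤ C := by
  simpa using norm_integral_le_of_norm_le_const (μ := μ) (Filter.Eventually.of_forall h)

lemma continuousOn_integral_of_compactSpace {X : Type*} [TopologicalSpace X] {F : X → G → V}
    {S : Set X} (hF : ContinuousOn (Function.uncurry F) (S ×ˢ univ)) :
    ContinuousOn (fun x => ∫ g, F x g ∂μ) S := by
  have hc : ∀ x ∈ S, Continuous (F x) := fun x hx =>
    continuousOn_univ.1 (hF.comp (f := fun g => (x, g)) (by fun_prop) fun g _ => ⟨hx, mem_univ _⟩)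
  intro x hx
  rw [ContinuousWithinAt, Metric.tendsto_nhds]
  intro ε hε
  filter_upwards [eventually_forall_norm_sub_lt hF hx (half_pos hε), self_mem_nhdsWithin]
    with y hy hyS
  rw [dist_eq_norm, ← integral_sub (integrable_of_continuous μ (hc y hyS))
    (integrable_of_continuous μ (hc x hx))]
  exact (norm_integral_le_of_forall_norm_le μ fun g => (hy g).le).trans_lt (half_lt_self hε)

lemma hasFDerivWithinAt_integral_of_compactSpace [CompleteSpace V] {F : E → G → V}
    {F' : E → G → E →L[ℝ] V} {S : Set E} (hS : Convex ℝ S)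
    (hF : ContinuousOn (Function.uncurry F) (S ×ˢ univ))
    (hF' : ContinuousOn (Function.uncurry F') (S ×ˢ univ))
    (hd : ∀ x ∈ S, ∀ g, HasFDerivWithinAt (F · g) (F' x g) S x) {x : E} (hx : x ∈ S) :
    HasFDerivWithinAt (fun y => ∫ g, F y g ∂μ) (∫ g, F' x g ∂μ) S x := by
  have hc : ∀ x ∈ S, Continuous (F x) := fun x hx =>
    continuousOn_univ.1 (hF.comp (f := fun g => (x, g)) (by fun_prop) fun g _ => ⟨hx, mem_univ _⟩)
  have hc' : Continuous (F' x) :=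
    continuousOn_univ.1 (hF'.comp (f := fun g => (x, g)) (by fun_prop) fun g _ => ⟨hx, mem_univ _⟩)
  rw [hasFDerivWithinAt_iff_isLittleO, Asymptotics.isLittleO_iff]
  intro ε hε
  obtain ⟨r, hr, hball⟩ := Metric.mem_nhdsWithin_iff.1 (eventually_forall_norm_sub_lt hF' hx hε)
  filter_upwards [inter_mem_nhdsWithin S (Metric.ball_mem_nhds x hr)] with y hy
  rw [ContinuousLinearMap.integral_apply (integrable_of_continuous μ hc'),
    ← integral_sub (integrable_of_continuous μ (hc y hy.1)) (integrable_of_continuous μ (hc x hx)),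
    ← integral_sub]
  · refine norm_integral_le_of_forall_norm_le μ fun g => ?_
    refine ((hS.inter (convex_ball x r)).norm_image_sub_le_of_norm_hasFDerivWithin_le'
      (f := (F · g)) (f' := fun z => F' z g) (φ := F' x g) (C := ε) (x := x) (y := y) ?_ ?_ ?_ ?_)
    · exact fun z hz => (hd z hz.1 g).mono inter_subset_left
    · exact fun z hz => (hball ⟨hz.2, hz.1⟩ g).le
    · exact ⟨hx, Metric.mem_ball_self hr⟩
    · exact hy
  · exact integrable_of_continuous μ ((hc y hy.1).sub (hc x hx))
  · exact integrable_of_continuous μ (by fun_prop)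

end ParametricIntegral

section ParametricIntegralSmooth

open MeasureTheory

universe u

variable {E : Type u} [NormedAddCommGroup E] [NormedSpace ℝ E]
  {EG : Type*} [NormedAddCommGroup EG] [NormedSpace ℝ EG] {HG : Type*} [TopologicalSpace HG]
  (IG : ModelWithCorners ℝ EG HG)
  {G : Type*} [TopologicalSpace G] [ChartedSpace HG G] [IsManifold IG ∞ G]
  [CompactSpace G] [MeasurableSpace G] [BorelSpace G]
  (μ : Measure G) [IsProbabilityMeasure μ]

lemma contDiffOn_integral_of_compactSpace_aux (n : ℕ) {S : Set E} (hS : Convex ℝ S)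
    (hu : UniqueDiffOn ℝ S) : ∀ {V : Type u} [NormedAddCommGroup V] [NormedSpace ℝ V]
    [CompleteSpace V] {F : E → G → V},
    ContMDiffOn (𝓘(ℝ, E).prod IG) 𝓘(ℝ, V) ∞ (Function.uncurry F) (S ×ˢ univ) →
    ContDiffOn ℝ n (fun x => ∫ g, F x g ∂μ) S := by
  induction n with
  | zero =>
    intro V _ _ _ F hF
    exact contDiffOn_zero.2 (continuousOn_integral_of_compactSpace μ hF.continuousOn)
  | succ n ih =>
    intro V _ _ _ F hF
    have hF' : ContMDiffOn (𝓘(ℝ, E).prod IG) 𝓘(ℝ, E →L[ℝ] V) ∞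
        (Function.uncurry fun x g => fderivWithin ℝ (F · g) S x) (S ×ˢ univ) := by
      rintro ⟨x, g⟩ hxg
      have h := ContMDiffWithinAt.mfderivWithin (I := 𝓘(ℝ, E)) (I' := 𝓘(ℝ, V))
        (J := 𝓘(ℝ, E).prod IG) (m := ∞) (n := ∞)
        (f := fun (z : E × G) (y : E) => F y z.2) (g := fun z : E × G => z.1)
        (t := S ×ˢ univ) (u := S) (x₀ := (x, g)) ?_ contMDiffWithinAt_fst hxg
        (fun z hz => hz.1) (by simp) hu.uniqueMDiffOn
      · have e := inTangentCoordinates_model_space (I := 𝓘(ℝ, E)) (I' := 𝓘(ℝ, V))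
          (fun z : E × G => z.1) (fun z => F z.1 z.2)
          (fun z => mfderivWithin 𝓘(ℝ, E) 𝓘(ℝ, V) (fun y => F y z.2) S z.1) (x, g)
        refine ContMDiffWithinAt.congr_of_eventuallyEq
          (f := inTangentCoordinates 𝓘(ℝ, E) 𝓘(ℝ, V) (fun z : E × G => z.1) (fun z => F z.1 z.2)
          (fun z => mfderivWithin 𝓘(ℝ, E) 𝓘(ℝ, V) (fun y => F y z.2) S z.1) (x, g)) h ?_ ?_
        · filter_upwards with z
          rw [e]
          exact mfderivWithin_eq_fderivWithin.symm
        · rw [e]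
          exact mfderivWithin_eq_fderivWithin.symm
      · exact ContMDiffWithinAt.comp (t := S ×ˢ univ) (I' := 𝓘(ℝ, E).prod IG)
          (g := Function.uncurry F) (f := fun w : (E × G) × E => (w.2, w.1.2)) ((x, g), x)
          (hF (x, g) hxg)
          (contMDiffWithinAt_snd.prodMk ((contMDiff_snd.comp contMDiff_fst) _).contMDiffWithinAt)
          (fun w hw => ⟨hw.2, mem_univ _⟩)
    have hd : ∀ x ∈ S, ∀ g, HasFDerivWithinAt (F · g) (fderivWithin ℝ (F · g) S x) S x := by
      intro x hx g
      have h1 : ContMDiffWithinAt 𝓘(ℝ, E) 𝓘(ℝ, V) ∞ (F · g) S x :=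
        ContMDiffWithinAt.comp (t := S ×ˢ univ) (I' := 𝓘(ℝ, E).prod IG)
          (g := Function.uncurry F) (f := fun y : E => (y, g)) x
          (hF (x, g) ⟨hx, mem_univ _⟩)
          (contMDiffWithinAt_id.prodMk contMDiffWithinAt_const) (fun w hw => ⟨hw, mem_univ _⟩)
      exact (h1.contDiffWithinAt.differentiableWithinAt (by simp)).hasFDerivWithinAt
    have hn : ((n + 1 : ℕ) : WithTop ℕ∞) = (n : WithTop ℕ∞) + 1 := by push_cast; rfl
    rw [hn, contDiffOn_succ_iff_hasFDerivWithinAt_of_uniqueDiffOn hu]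
    refine ⟨fun h => absurd h (by simp), _, ih hF', fun x hx => ?_⟩
    exact hasFDerivWithinAt_integral_of_compactSpace μ hS hF.continuousOn hF'.continuousOn hd hx

lemma contDiffOn_integral_of_compactSpace {S : Set E} (hS : Convex ℝ S)
    (hu : UniqueDiffOn ℝ S) {F : E → G → ℝ}
    (hF : ContMDiffOn (𝓘(ℝ, E).prod IG) 𝓘(ℝ, ℝ) ∞ (Function.uncurry F) (S ×ˢ univ)) :
    ContDiffOn ℝ ∞ (fun x => ∫ g, F x g ∂μ) S := by
  rw [contDiffOn_infty]
  intro n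
  let L : ℝ ≃L[ℝ] ULift.{u} ℝ := ContinuousLinearEquiv.ulift.symm
  have h := contDiffOn_integral_of_compactSpace_aux IG μ n hS hu (F := fun x g => L (F x g))
    ((L.contDiff.contMDiff).comp_contMDiffOn hF)
  have h2 := L.symm.contDiff.comp_contDiffOn h
  refine h2.congr fun x hx => ?_
  simp only [Function.comp]
  rw [L.integral_comp_comm]
  simp

lemma contMDiffOn_integral_of_compactSpace {H : Type*} [TopologicalSpace H]
    (I : ModelWithCorners ℝ E H) {N : Type*} [TopologicalSpace N] [ChartedSpace H N]
    [IsManifold I ∞ N] {U : Set N} (hU : IsOpen U) {F : N → G → ℝ}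
    (hF : ContMDiffOn (I.prod IG) 𝓘(ℝ, ℝ) ∞ (Function.uncurry F) (U ×ˢ univ)) :
    ContMDiffOn I 𝓘(ℝ, ℝ) ∞ (fun x => ∫ g, F x g ∂μ) U := by
  intro x hx
  have hmem : (extChartAt I x).target ∩ (extChartAt I x).symm ⁻¹' U ∈
      𝓝[range I] (extChartAt I x x) :=
    Filter.inter_mem (extChartAt_target_mem_nhdsWithin x)
      (mem_nhdsWithin_of_mem_nhds ((continuousAt_extChartAt_symm x).preimage_mem_nhds
        (by simpa using hU.mem_nhds hx)))
  obtain ⟨r, hr, hball⟩ := Metric.mem_nhdsWithin_iff.1 hmem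
  have hS : ContDiffOn ℝ ∞ (fun y => ∫ g, F ((extChartAt I x).symm y) g ∂μ)
      (range I ∩ Metric.ball (extChartAt I x x) r) := by
    refine contDiffOn_integral_of_compactSpace IG μ (I.convex_range.inter (convex_ball _ _))
      (I.uniqueDiffOn.inter Metric.isOpen_ball) ?_
    refine hF.comp (f := fun z : E × G => ((extChartAt I x).symm z.1, z.2)) ?_ ?_
    · refine ContMDiffOn.prodMk ?_ contMDiffOn_snd
      exact (contMDiffOn_extChartAt_symm x).comp contMDiffOn_fst
        fun z hz => (hball ⟨hz.1.2, hz.1.1⟩).1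
    · exact fun z hz => ⟨(hball ⟨hz.1.2, hz.1.1⟩).2, mem_univ _⟩
  have hmaps : extChartAt I x ⁻¹' (range I ∩ Metric.ball (extChartAt I x x) r) ∈ 𝓝 x := by
    filter_upwards [(continuousAt_extChartAt (I := I) x).preimage_mem_nhds
      (Metric.ball_mem_nhds _ hr)] with y hy
    exact ⟨mem_range_self _, hy⟩
  have hcomp := ((hS _ ⟨mem_range_self _, Metric.mem_ball_self hr⟩).contMDiffWithinAt).comp
    (I := I) (s := extChartAt I x ⁻¹' (range I ∩ Metric.ball (extChartAt I x x) r)) x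
    (contMDiffAt_extChartAt (n := ∞)).contMDiffWithinAt (mapsTo_preimage _ _)
  refine ((hcomp.contMDiffAt hmaps).congr_of_eventuallyEq ?_).contMDiffWithinAt
  filter_upwards [extChartAt_source_mem_nhds (I := I) x] with y hy
  simp only [Function.comp_apply, (extChartAt I x).left_inv hy]

end ParametricIntegralSmooth

end HamiltonianCompletion

end

noncomputable section

namespace HamiltonianCompletion

/-! ### Naturality of the exterior derivative -/

section Naturality

variable {E : Type*} [NormedAddCommGroup E] [NormedSpace ℝ E]
  {H : Type*} [TopologicalSpace H] (I : ModelWithCorners ℝ E H)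
  {N : Type*} [TopologicalSpace N] [ChartedSpace H N]
  {E' : Type*} [NormedAddCommGroup E'] [NormedSpace ℝ E']

/-- The pullback of a `k`-form on `N` under a map `P : E' → N` that is smooth on `S`. -/
def pullbackForm {k : ℕ} (σ : (x : N) → TangentSpace I x [⋀^Fin k]→L[ℝ] ℝ) (P : E' → N)
    (S : Set E') (y : E') : E' [⋀^Fin k]→L[ℝ] ℝ :=
  (σ (P y)).compContinuousLinearMap (mfderivWithin 𝓘(ℝ, E') I P S y)

variable {I}

lemma form_apply_congr {k : ℕ} (σ : (x : N) → TangentSpace I x [⋀^Fin k]→L[ℝ] ℝ) {x x' : N}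
    (h : x = x') {u w : Fin k → E} (huw : u = w) : σ x u = σ x' w := by
  subst h huw; rfl

lemma two_le_infty : minSmoothness ℝ 2 ≤ (∞ : WithTop ℕ∞) := by
  rw [minSmoothness_of_isRCLikeNormedField]
  exact WithTop.coe_le_coe.2 (le_top : (2 : ℕ∞) ≤ ⊤)

variable [IsManifold I ∞ N]

omit [IsManifold I ∞ N] in
lemma hasMFDerivWithinAt_of_contMDiffWithinAt {P : E' → N} {S : Set E'} {y : E'}
    (hP : ContMDiffWithinAt 𝓘(ℝ, E') I ∞ P S y) :
    HasMFDerivWithinAt 𝓘(ℝ, E') I P S y (mfderivWithin 𝓘(ℝ, E') I P S y) :=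
  (hP.mdifferentiableWithinAt (by simp)).hasMFDerivWithinAt

lemma contDiffOn_extChartAt_comp {P : E' → N} {S : Set E'}
    (hP : ContMDiffOn 𝓘(ℝ, E') I ∞ P S) (x : N) {y : E'} (hy : y ∈ S)
    (hx : P y ∈ (chartAt H x).source) :
    ContDiffWithinAt ℝ ∞ (extChartAt I x ∘ P) S y :=
  ((contMDiffAt_extChartAt' hx).comp_contMDiffWithinAt y (hP y hy)).contDiffWithinAt

omit [IsManifold I ∞ N] in
lemma eventually_mem_chart_source {P : E' → N} {S : Set E'}
    (hP : ContMDiffOn 𝓘(ℝ, E') I ∞ P S) {y₀ : E'} (hy₀ : y₀ ∈ S) :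
    ∀ᶠ y in 𝓝[S] y₀, P y ∈ (chartAt H (P y₀)).source :=
  (hP y₀ hy₀).continuousWithinAt.eventually ((chart_source_mem_nhds H (P y₀)))

lemma mfderivWithin_eq_comp_extChartAt {P : E' → N} {S : Set E'}
    (hP : ContMDiffOn 𝓘(ℝ, E') I ∞ P S) (hS : UniqueDiffOn ℝ S) (x : N) {y : E'} (hy : y ∈ S)
    (hx : P y ∈ (chartAt H x).source) (w : E') :
    (mfderivWithin 𝓘(ℝ, E') I P S y w : E) =
      (mfderivWithin 𝓘(ℝ, E) I (extChartAt I x).symm (range I) (extChartAt I x (P y))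
        (fderivWithin ℝ (extChartAt I x ∘ P) S y w) : E) := by
  have hx' : P y ∈ (extChartAt I x).source := by rwa [extChartAt_source]
  have h1 : HasMFDerivWithinAt 𝓘(ℝ, E) I (extChartAt I x).symm (range I)
      ((extChartAt I x ∘ P) y)
      (mfderivWithin 𝓘(ℝ, E) I (extChartAt I x).symm (range I) ((extChartAt I x ∘ P) y)) :=
    (mdifferentiableWithinAt_extChartAt_symm
      ((extChartAt I x).map_source hx')).hasMFDerivWithinAt
  have h2 : HasMFDerivWithinAt 𝓘(ℝ, E') 𝓘(ℝ, E) (extChartAt I x ∘ P) S y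
      (fderivWithin ℝ (extChartAt I x ∘ P) S y) :=
    (((contDiffOn_extChartAt_comp hP x hy hx).differentiableWithinAt
      (by simp)).hasFDerivWithinAt).hasMFDerivWithinAt
  have h3 := h1.comp y h2 (fun z _ => mem_range_self _)
  have h4 : HasMFDerivWithinAt 𝓘(ℝ, E') I P S y _ := h3.congr_of_eventuallyEq (f₁ := P) (by
    have hs := (hP y hy).continuousWithinAt.eventually
      ((chartAt H x).open_source.mem_nhds hx)
    filter_upwards [hs] with z hz
    have hz' : P z ∈ (extChartAt I x).source := by rwa [extChartAt_source]
    exact ((extChartAt I x).left_inv hz').symm) ((extChartAt I x).left_inv hx').symm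
  exact congrArg (fun L => L w) (h4.mfderivWithin (hS.uniqueMDiffOn y hy))

lemma pullbackForm_eventuallyEq {k : ℕ} (σ : (x : N) → TangentSpace I x [⋀^Fin k]→L[ℝ] ℝ)
    {P : E' → N} {S : Set E'} (hP : ContMDiffOn 𝓘(ℝ, E') I ∞ P S) (hS : UniqueDiffOn ℝ S)
    {y₀ : E'} (hy₀ : y₀ ∈ S) :
    pullbackForm I σ P S =ᶠ[𝓝[S] y₀] fun y =>
      (formInChart I σ (P y₀) ((extChartAt I (P y₀) ∘ P) y)).compContinuousLinearMap
        (fderivWithin ℝ (extChartAt I (P y₀) ∘ P) S y) := by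
  filter_upwards [eventually_mem_chart_source hP hy₀, self_mem_nhdsWithin] with y hy hyS
  have hy' : P y ∈ (extChartAt I (P y₀)).source := by rwa [extChartAt_source]
  ext u
  refine form_apply_congr σ ((extChartAt I (P y₀)).left_inv hy').symm ?_
  funext i
  exact mfderivWithin_eq_comp_extChartAt hP hS (P y₀) hyS hy (u i)

omit [IsManifold I ∞ N] in
lemma IsSmoothForm.contDiffWithinAt {k : ℕ} {σ : (x : N) → TangentSpace I x [⋀^Fin k]→L[ℝ] ℝ}
    (hσ : IsSmoothForm I σ) (x₀ : N) {y : E} (hy : y ∈ (extChartAt I x₀).target) :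
    ContDiffWithinAt ℝ ∞ (formInChart I σ x₀) (range I) y :=
  (hσ x₀ y hy).mono_of_mem_nhdsWithin (extChartAt_target_mem_nhdsWithin_of_mem hy)

lemma IsSmoothForm.differentiableWithinAt_pullbackForm {k : ℕ}
    {σ : (x : N) → TangentSpace I x [⋀^Fin k]→L[ℝ] ℝ} (hσ : IsSmoothForm I σ)
    {P : E' → N} {S : Set E'} (hP : ContMDiffOn 𝓘(ℝ, E') I ∞ P S) (hS : UniqueDiffOn ℝ S)
    {y₀ : E'} (hy₀ : y₀ ∈ S) : DifferentiableWithinAt ℝ (pullbackForm I σ P S) S y₀ := by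
  have hf := contDiffOn_extChartAt_comp hP (P y₀) hy₀ (mem_chart_source H _)
  have h1 : DifferentiableWithinAt ℝ (fun y => formInChart I σ (P y₀)
      ((extChartAt I (P y₀) ∘ P) y)) S y₀ :=
    ((hσ.contDiffWithinAt (P y₀) (mem_extChartAt_target (P y₀))).differentiableWithinAt
      (by simp)).comp (f := extChartAt I (P y₀) ∘ P) y₀ (hf.differentiableWithinAt (by simp))
      fun _ _ => mem_range_self _
  have h2 : DifferentiableWithinAt ℝ (fderivWithin ℝ (extChartAt I (P y₀) ∘ P) S) S y₀ :=
    (hf.fderivWithin_right hS (m := 1) (by norm_cast) hy₀).differentiableWithinAt (by simp)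
  exact ((h1.hasFDerivWithinAt.continuousAlternatingMapCompContinuousLinearMap
    h2.hasFDerivWithinAt).differentiableWithinAt).congr_of_eventuallyEq
    (pullbackForm_eventuallyEq σ hP hS hy₀)
    ((pullbackForm_eventuallyEq σ hP hS hy₀).self_of_nhdsWithin hy₀)

theorem IsSmoothForm.extDerivWithin_pullbackForm {k : ℕ}
    {σ : (x : N) → TangentSpace I x [⋀^Fin k]→L[ℝ] ℝ} (hσ : IsSmoothForm I σ)
    {P : E' → N} {S : Set E'} (hP : ContMDiffOn 𝓘(ℝ, E') I ∞ P S) (hS : UniqueDiffOn ℝ S)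
    (hSc : S ⊆ closure (interior S)) {y : E'} (hy : y ∈ S) :
    extDerivWithin (pullbackForm I σ P S) S y =
      pullbackForm I (exteriorDerivative I σ) P S y := by
  rw [(pullbackForm_eventuallyEq σ hP hS hy).extDerivWithin_eq_of_mem hy]
  rw [extDerivWithin_pullback (t := range I) (r := ∞) (f := extChartAt I (P y) ∘ P)
    ((hσ.contDiffWithinAt (P y) (mem_extChartAt_target (P y))).differentiableWithinAt (by simp))
    (contDiffOn_extChartAt_comp hP (P y) hy (mem_chart_source H _)) two_le_infty hS (hSc hy) hy
    fun _ _ => mem_range_self _]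
  have h1 : HasMFDerivWithinAt 𝓘(ℝ, E') 𝓘(ℝ, E) (extChartAt I (P y) ∘ P) S y
      ((mfderiv I 𝓘(ℝ, E) (extChartAt I (P y)) (P y)).comp (mfderivWithin 𝓘(ℝ, E') I P S y)) :=
    ((mdifferentiableAt_extChartAt (mem_chart_source H (P y))).hasMFDerivAt).comp_hasMFDerivWithinAt
      y (hasMFDerivWithinAt_of_contMDiffWithinAt (hP y hy))
  have h2 : ∀ w : E', fderivWithin ℝ (extChartAt I (P y) ∘ P) S y w =
      (mfderiv I 𝓘(ℝ, E) (extChartAt I (P y)) (P y)) (mfderivWithin 𝓘(ℝ, E') I P S y w) := by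
    intro w
    rw [← mfderivWithin_eq_fderivWithin]
    exact congrArg (fun L => L w) (h1.mfderivWithin (hS.uniqueMDiffOn y hy))
  ext u
  exact congrArg (fun w : Fin (k + 1) → E =>
    extDerivWithin (formInChart I σ (P y)) (range I) (extChartAt I (P y) (P y)) w)
    (funext fun i => h2 (u i))

lemma mfderivWithin_extChartAt_symm_target (x₀ : N) {y : E} (hy : y ∈ (extChartAt I x₀).target) :
    mfderivWithin 𝓘(ℝ, E) I (extChartAt I x₀).symm (extChartAt I x₀).target y =
      mfderivWithin 𝓘(ℝ, E) I (extChartAt I x₀).symm (range I) y :=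
  (mdifferentiableWithinAt_extChartAt_symm hy).mfderivWithin_mono
    ((uniqueDiffOn_extChartAt_target x₀).uniqueMDiffOn y hy) (extChartAt_target_subset_range x₀)

lemma pullbackForm_extChartAt_symm_target {k : ℕ}
    (σ : (x : N) → TangentSpace I x [⋀^Fin k]→L[ℝ] ℝ) (x₀ : N) {y : E}
    (hy : y ∈ (extChartAt I x₀).target) :
    pullbackForm I σ (extChartAt I x₀).symm (extChartAt I x₀).target y = formInChart I σ x₀ y := by
  rw [pullbackForm, mfderivWithin_extChartAt_symm_target x₀ hy, formInChart]

lemma IsSmoothForm.formInChart_exteriorDerivative {k : ℕ}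
    {σ : (x : N) → TangentSpace I x [⋀^Fin k]→L[ℝ] ℝ} (hσ : IsSmoothForm I σ) (x₀ : N) {y : E}
    (hy : y ∈ (extChartAt I x₀).target) :
    formInChart I (exteriorDerivative I σ) x₀ y =
      extDerivWithin (formInChart I σ x₀) (range I) y := by
  rw [← pullbackForm_extChartAt_symm_target _ x₀ hy,
    ← hσ.extDerivWithin_pullbackForm (contMDiffOn_extChartAt_symm x₀)
      (uniqueDiffOn_extChartAt_target x₀) extChartAt_target_subset_closure_interior hy,
    extDerivWithin_congr' (fun z hz => pullbackForm_extChartAt_symm_target σ x₀ hz) hy,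
    extDerivWithin, extDerivWithin]
  have hset : (extChartAt I x₀).target =ᶠ[𝓝 y] range I := by
    rw [← nhdsWithin_eq_iff_eventuallyEq]
    exact nhdsWithin_extChartAt_target_eq_of_mem hy
  rw [fderivWithin_congr_set hset]

theorem IsSmoothForm.isSmoothForm_exteriorDerivative {k : ℕ}
    {σ : (x : N) → TangentSpace I x [⋀^Fin k]→L[ℝ] ℝ} (hσ : IsSmoothForm I σ) :
    IsSmoothForm I (exteriorDerivative I σ) := by
  intro x₀ y hy
  have hev : formInChart I (exteriorDerivative I σ) x₀ =ᶠ[𝓝[(extChartAt I x₀).target] y]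
      fun z => ContinuousAlternatingMap.alternatizeUncurryFinCLM ℝ E ℝ (n := k)
        (fderivWithin ℝ (formInChart I σ x₀) (range I) z) := by
    filter_upwards [self_mem_nhdsWithin] with z hz
    exact hσ.formInChart_exteriorDerivative x₀ hz
  refine ContDiffWithinAt.congr_of_eventuallyEq ?_ hev (hev.self_of_nhdsWithin hy)
  have hL : ContDiff ℝ ∞ (fun L : E →L[ℝ] E [⋀^Fin k]→L[ℝ] ℝ =>
      ContinuousAlternatingMap.alternatizeUncurryFinCLM ℝ E ℝ L) := by fun_prop
  refine hL.comp_contDiffWithinAt ?_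
  exact ((hσ.contDiffWithinAt x₀ hy).fderivWithin_right I.uniqueDiffOn (m := ∞) (by simp)
    (extChartAt_target_subset_range x₀ hy)).mono (extChartAt_target_subset_range x₀)

theorem IsSmoothForm.exteriorDerivative_exteriorDerivative {k : ℕ}
    {σ : (x : N) → TangentSpace I x [⋀^Fin k]→L[ℝ] ℝ} (hσ : IsSmoothForm I σ) (x : N) :
    exteriorDerivative I (exteriorDerivative I σ) x = 0 := by
  have hev : formInChart I (exteriorDerivative I σ) x
      =ᶠ[𝓝[range I] (extChartAt I x x)] extDerivWithin (formInChart I σ x) (range I) := by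
    filter_upwards [extChartAt_target_mem_nhdsWithin x] with z hz
    exact hσ.formInChart_exteriorDerivative x hz
  have hx : extChartAt I x x ∈ range I := mem_range_self _
  have h0 : extDerivWithin (formInChart I (exteriorDerivative I σ) x) (range I)
      (extChartAt I x x) = 0 := by
    rw [hev.extDerivWithin_eq_of_mem hx]
    exact extDerivWithin_extDerivWithin_apply
      (hσ.contDiffWithinAt x (mem_extChartAt_target x)) two_le_infty I.uniqueDiffOn
      (I.range_subset_closure_interior hx) hx
  rw [exteriorDerivative, h0]
  rfl

omit [IsManifold I ∞ N] in
lemma IsSmoothForm.sub {k : ℕ} {σ τ : (x : N) → TangentSpace I x [⋀^Fin k]→L[ℝ] ℝ}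
    (hσ : IsSmoothForm I σ) (hτ : IsSmoothForm I τ) : IsSmoothForm I fun x => σ x - τ x :=
  fun x₀ => ((hσ x₀).sub (hτ x₀)).congr fun _ _ => rfl

omit [IsManifold I ∞ N] in
lemma IsSmoothForm.exteriorDerivative_sub {k : ℕ}
    {σ τ : (x : N) → TangentSpace I x [⋀^Fin k]→L[ℝ] ℝ}
    (hσ : IsSmoothForm I σ) (hτ : IsSmoothForm I τ) (x : N) :
    exteriorDerivative I (fun y => σ y - τ y) x =
      exteriorDerivative I σ x - exteriorDerivative I τ x := by
  have hu := I.uniqueDiffOn (extChartAt I x x) (mem_range_self _)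
  have h1 := (hσ.contDiffWithinAt x (mem_extChartAt_target x)).differentiableWithinAt
    (n := ∞) (by simp)
  have h2 := (hτ.contDiffWithinAt x (mem_extChartAt_target x)).differentiableWithinAt
    (n := ∞) (by simp)
  have h3 : extDerivWithin (formInChart I (fun y => σ y - τ y) x) (range I) (extChartAt I x x) =
      extDerivWithin (formInChart I σ x) (range I) (extChartAt I x x) -
      extDerivWithin (formInChart I τ x) (range I) (extChartAt I x x) := by
    have h4 : formInChart I (fun y => σ y - τ y) x = formInChart I σ x - formInChart I τ x := rfl
    rw [h4, extDerivWithin, fderivWithin_sub hu h1 h2]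
    exact map_sub (ContinuousAlternatingMap.alternatizeUncurryFinCLM ℝ E ℝ) _ _
  rw [exteriorDerivative, h3]
  rfl

omit [IsManifold I ∞ N] in
lemma exteriorDerivative_eq_zero_of_eventually {k : ℕ}
    {σ : (x : N) → TangentSpace I x [⋀^Fin k]→L[ℝ] ℝ} {x : N} (h : ∀ᶠ y in 𝓝 x, σ y = 0) :
    exteriorDerivative I σ x = 0 := by
  have hev : formInChart I σ x =ᶠ[𝓝 (extChartAt I x x)] 0 := by
    have := (continuousAt_extChartAt_symm (I := I) x).eventually
      (by rwa [(extChartAt I x).left_inv (mem_extChartAt_source x)])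
    filter_upwards [this] with y hy
    rw [formInChart, hy]
    rfl
  have h0 : extDerivWithin (formInChart I σ x) (range I) (extChartAt I x x) = 0 := by
    rw [hev.extDerivWithin_eq_nhds, extDerivWithin]
    simpa using map_zero (ContinuousAlternatingMap.alternatizeUncurryFinCLM ℝ E ℝ (n := k))
  rw [exteriorDerivative, h0]
  rfl

lemma mfderivWithin_range_extChartAt_symm_apply (x : N) (u : E) :
    (mfderivWithin 𝓘(ℝ, E) I (extChartAt I x).symm (range I) (extChartAt I x x) u : E) = u :=
  congrArg (fun L => L u) (mfderivWithin_range_extChartAt_symm (I := I) (x := x))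

end Naturality

section Invariance

variable {EG : Type*} [NormedAddCommGroup EG] [NormedSpace ℝ EG]
  {HG : Type*} [TopologicalSpace HG] (IG : ModelWithCorners ℝ EG HG)
  {G : Type*} [TopologicalSpace G] [ChartedSpace HG G] [Group G]
  {E : Type*} [NormedAddCommGroup E] [NormedSpace ℝ E]
  {H : Type*} [TopologicalSpace H] {I : ModelWithCorners ℝ E H}
  {N : Type*} [TopologicalSpace N] [ChartedSpace H N]
  [MulAction G N] [ContMDiffSMul IG I ∞ G N]
  {E' : Type*} [NormedAddCommGroup E'] [NormedSpace ℝ E']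

include IG in
lemma mfderivWithin_const_smul {P : E' → N} {S : Set E'}
    (hP : ContMDiffOn 𝓘(ℝ, E') I ∞ P S) (hS : UniqueDiffOn ℝ S) (g : G) {y : E'} (hy : y ∈ S)
    (w : E') :
    mfderivWithin 𝓘(ℝ, E') I (fun z => g • P z) S y w =
      mfderiv I I (fun x : N => g • x) (P y) (mfderivWithin 𝓘(ℝ, E') I P S y w) := by
  have h := mfderiv_comp_mfderivWithin (I := 𝓘(ℝ, E')) (I' := I) (I'' := I) y
    (g := fun x : N => g • x) (f := P) (s := S)
    ((ContMDiffSMul.contMDiff_const_smul (I := IG) (n := ∞) g).mdifferentiable (by simp) _)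
    ((hP y hy).mdifferentiableWithinAt (by simp)) (hS.uniqueMDiffOn y hy)
  exact congrArg (fun L => L w) h

include IG in
lemma IsInvariantForm.pullbackForm_const_smul {k : ℕ}
    {σ : (x : N) → TangentSpace I x [⋀^Fin k]→L[ℝ] ℝ} (hinv : IsInvariantForm I G σ)
    {P : E' → N} {S : Set E'} (hP : ContMDiffOn 𝓘(ℝ, E') I ∞ P S) (hS : UniqueDiffOn ℝ S)
    (g : G) {y : E'} (hy : y ∈ S) :
    pullbackForm I σ (fun z => g • P z) S y = pullbackForm I σ P S y := by
  ext u
  refine (form_apply_congr σ rfl (funext fun i =>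
    mfderivWithin_const_smul IG hP hS g hy (u i))).trans ?_
  exact congrArg (fun L : TangentSpace I (P y) [⋀^Fin k]→L[ℝ] ℝ =>
    L fun i => mfderivWithin 𝓘(ℝ, E') I P S y (u i)) (hinv g (P y))

include IG in
theorem IsInvariantForm.exteriorDerivative [IsManifold I ∞ N] {k : ℕ}
    {σ : (x : N) → TangentSpace I x [⋀^Fin k]→L[ℝ] ℝ} (hinv : IsInvariantForm I G σ)
    (hσ : IsSmoothForm I σ) : IsInvariantForm I G (exteriorDerivative I σ) := by
  intro g x
  have hP := contMDiffOn_extChartAt_symm (I := I) (n := ∞) x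
  have hS := uniqueDiffOn_extChartAt_target (I := I) x
  have hSc := extChartAt_target_subset_closure_interior (I := I) (x := x)
  have hy := mem_extChartAt_target (I := I) x
  have hP' : ContMDiffOn 𝓘(ℝ, E) I ∞ (fun z => g • (extChartAt I x).symm z)
      (extChartAt I x).target :=
    (ContMDiffSMul.contMDiff_const_smul (I := IG) (n := ∞) g).comp_contMDiffOn hP
  have h1 := hσ.extDerivWithin_pullbackForm hP' hS hSc hy
  rw [extDerivWithin_congr' (fun z hz => hinv.pullbackForm_const_smul IG hP hS g hz) hy,
    hσ.extDerivWithin_pullbackForm hP hS hSc hy] at h1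
  have hx : (extChartAt I x).symm (extChartAt I x x) = x :=
    (extChartAt I x).left_inv (mem_extChartAt_source x)
  ext u
  have h2 := congrArg (fun L : E [⋀^Fin (k + 1)]→L[ℝ] ℝ => L u) h1
  have h3 : ∀ w : E, mfderivWithin 𝓘(ℝ, E) I (extChartAt I x).symm (extChartAt I x).target
      (extChartAt I x x) w = w := fun w => by
    rw [mfderivWithin_extChartAt_symm_target x hy]
    exact mfderivWithin_range_extChartAt_symm_apply x w
  have h4 : ∀ w : E, (mfderivWithin 𝓘(ℝ, E) I (fun z => g • (extChartAt I x).symm z)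
      (extChartAt I x).target (extChartAt I x x) w : E) =
      (mfderiv I I (fun z : N => g • z) x w : E) := fun w => by
    refine (mfderivWithin_const_smul IG hP hS g hy w).trans ?_
    rw [h3 w, hx]
  refine Eq.trans ?_ (h2.symm.trans ?_)
  · exact form_apply_congr (HamiltonianCompletion.exteriorDerivative I σ)
      (congrArg (g • ·) hx.symm) (funext fun i => (h4 (u i)).symm)
  · exact form_apply_congr (HamiltonianCompletion.exteriorDerivative I σ) hx
      (funext fun i => h3 (u i))

end Invariance

end HamiltonianCompletion

end

noncomputable section

namespace HamiltonianCompletion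

/-! ### Cartan's formula for invariant forms -/

section Cartan

variable {EG : Type*} [NormedAddCommGroup EG] [NormedSpace ℝ EG]
  {HG : Type*} [TopologicalSpace HG] (IG : ModelWithCorners ℝ EG HG)
  {G : Type*} [TopologicalSpace G] [ChartedSpace HG G] [Group G] [IsManifold IG ∞ G]
  {E : Type*} [NormedAddCommGroup E] [NormedSpace ℝ E]
  {H : Type*} [TopologicalSpace H] {I : ModelWithCorners ℝ E H}
  {N : Type*} [TopologicalSpace N] [ChartedSpace H N] [IsManifold I ∞ N]
  [MulAction G N] [ContMDiffSMul IG I ∞ G N]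

variable (I N) in
/-- The action map read in charts around `1 : G` and `x : N`. -/
def actionInCharts (x : N) (z : EG × E) : N :=
  (extChartAt IG (1 : G)).symm z.1 • (extChartAt I x).symm z.2

variable (G) in
/-- The domain of the action map read in charts. -/
def actionChartDomain (x : N) : Set (EG × E) :=
  (extChartAt IG (1 : G)).target ×ˢ (extChartAt I x).target

lemma contMDiffOn_actionInCharts (x : N) :
    ContMDiffOn 𝓘(ℝ, EG × E) I ∞ (actionInCharts IG (G := G) I N x)
      (actionChartDomain IG G (I := I) x) :=
  ContMDiffOn.smul (I := IG)
    ((contMDiffOn_extChartAt_symm (I := IG) (1 : G)).comp contDiff_fst.contMDiff.contMDiffOn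
      fun _ hz => hz.1)
    ((contMDiffOn_extChartAt_symm (I := I) x).comp contDiff_snd.contMDiff.contMDiffOn
      fun _ hz => hz.2)

omit [MulAction G N] [ContMDiffSMul IG I ∞ G N] [IsManifold I ∞ N] [IsManifold IG ∞ G] in
lemma uniqueDiffOn_actionChartDomain (x : N) :
    UniqueDiffOn ℝ (actionChartDomain IG G (I := I) x) :=
  (uniqueDiffOn_extChartAt_target _).prod (uniqueDiffOn_extChartAt_target _)

omit [MulAction G N] [ContMDiffSMul IG I ∞ G N] [IsManifold I ∞ N] [IsManifold IG ∞ G] in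
lemma actionChartDomain_subset_closure_interior (x : N) :
    actionChartDomain IG G (I := I) x ⊆ closure (interior (actionChartDomain IG G (I := I) x)) := by
  rw [actionChartDomain, interior_prod_eq, closure_prod_eq]
  exact prod_mono extChartAt_target_subset_closure_interior
    extChartAt_target_subset_closure_interior

/-- The derivative of the action map along the manifold. -/
lemma mfderivWithin_actionInCharts_snd (x : N) {z : EG × E}
    (hz : z ∈ actionChartDomain IG G (I := I) x) (w : E) :
    (mfderivWithin 𝓘(ℝ, EG × E) I (actionInCharts IG (G := G) I N x)
      (actionChartDomain IG G (I := I) x) z ((0, w) : EG × E) : E) =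
    (mfderivWithin 𝓘(ℝ, E) I (fun y => (extChartAt IG (1 : G)).symm z.1 • (extChartAt I x).symm y)
      (extChartAt I x).target z.2 w : E) := by
  have h1 := hasMFDerivWithinAt_of_contMDiffWithinAt (contMDiffOn_actionInCharts IG (G := G) x z hz)
  have h2 : HasMFDerivWithinAt 𝓘(ℝ, E) 𝓘(ℝ, EG × E) (fun y : E => (z.1, y))
      (extChartAt I x).target z.2 (ContinuousLinearMap.inr ℝ EG E) :=
    (hasFDerivAt_prodMk_right z.1 z.2).hasFDerivWithinAt.hasMFDerivWithinAt
  have h3 := HasMFDerivWithinAt.comp (I' := 𝓘(ℝ, EG × E)) z.2 (f := fun y : E => (z.1, y)) h1 h2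
    (fun y hy => ⟨hz.1, hy⟩)
  have h4 := h3.mfderivWithin ((uniqueDiffOn_extChartAt_target x).uniqueMDiffOn z.2 hz.2)
  exact (congrArg (fun L => L w) h4).symm

/-- The derivative of the action map along the group, at the identity. -/
lemma mfderivWithin_actionInCharts_fst [IG.Boundaryless] (x : N) {y : E}
    (hy : y ∈ (extChartAt I x).target) (X : EG) :
    (mfderivWithin 𝓘(ℝ, EG × E) I (actionInCharts IG (G := G) I N x)
      (actionChartDomain IG G (I := I) x) (extChartAt IG (1 : G) 1, y) ((X, 0) : EG × E) : E) =
    (fundamentalField IG I (G := G) X ((extChartAt I x).symm y) : E) := by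
  set h₀ : EG := extChartAt IG (1 : G) 1 with hh₀
  have hz : (h₀, y) ∈ actionChartDomain IG G (I := I) x := ⟨mem_extChartAt_target _, hy⟩
  have h1 := hasMFDerivWithinAt_of_contMDiffWithinAt
    (contMDiffOn_actionInCharts IG (G := G) x _ hz)
  have h2 : HasMFDerivWithinAt 𝓘(ℝ, EG) 𝓘(ℝ, EG × E) (fun h : EG => (h, y))
      (extChartAt IG (1 : G)).target h₀ (ContinuousLinearMap.inl ℝ EG E) :=
    (hasFDerivAt_prodMk_left h₀ y).hasFDerivWithinAt.hasMFDerivWithinAt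
  have h3 := HasMFDerivWithinAt.comp (I' := 𝓘(ℝ, EG × E)) h₀ (f := fun h : EG => (h, y)) h1 h2
    (fun h hh => ⟨hh, hy⟩)
  have hu := (uniqueDiffOn_extChartAt_target (I := IG) (1 : G)).uniqueMDiffOn h₀
    (mem_extChartAt_target _)
  have h4 := h3.mfderivWithin hu
  have h5 := mfderiv_comp_mfderivWithin_of_eq (I := 𝓘(ℝ, EG)) (I' := IG) (I'' := I) (x := h₀)
    (y := (1 : G)) (s := (extChartAt IG (1 : G)).target)
    (g := fun g : G => g • (extChartAt I x).symm y)
    (f := (extChartAt IG (1 : G)).symm)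
    ((ContMDiff.smul (I := IG) (I' := I) (n := ∞) contMDiff_id contMDiff_const).mdifferentiable
      (by simp) _)
    ((contMDiffOn_extChartAt_symm (n := ∞) (1 : G) h₀
      (mem_extChartAt_target _)).mdifferentiableWithinAt (by simp)) hu
    ((extChartAt IG (1 : G)).left_inv (mem_extChartAt_source _))
  refine (congrArg (fun L => L X) h4).symm.trans ((congrArg (fun L => L X) h5).trans ?_)
  have h6 := mfderivWithin_range_extChartAt_symm_apply (I := IG) (1 : G) X
  rw [← mfderivWithin_extChartAt_symm_target (1 : G) (mem_extChartAt_target _)] at h6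
  exact congrArg (fun w : EG => (mfderiv IG I (fun g : G => g • (extChartAt I x).symm y) 1 w : E)) h6

lemma pullbackForm_actionInCharts_snd {β : (x : N) → TangentSpace I x →L[ℝ] ℝ}
    (hinv : IsInvariantForm I G (oneForm I β)) (x : N) {z : EG × E}
    (hz : z ∈ actionChartDomain IG G (I := I) x) (w : E) :
    pullbackForm I (oneForm I β) (actionInCharts IG (G := G) I N x)
      (actionChartDomain IG G (I := I) x) z ![((0, w) : EG × E)] =
    formInChart I (oneForm I β) x z.2 ![w] := by
  have hP := contMDiffOn_extChartAt_symm (I := I) (n := ∞) x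
  have hS := uniqueDiffOn_extChartAt_target (I := I) x
  rw [← pullbackForm_extChartAt_symm_target _ x hz.2,
    ← hinv.pullbackForm_const_smul IG hP hS ((extChartAt IG (1 : G)).symm z.1) hz.2]
  exact congrArg (fun w : E => (β (actionInCharts IG (G := G) I N x z) : E → ℝ) w)
    (mfderivWithin_actionInCharts_snd IG x hz w)

lemma pullbackForm_actionInCharts_fst [IG.Boundaryless] (β : (x : N) → TangentSpace I x →L[ℝ] ℝ)
    (x : N) {y : E} (hy : y ∈ (extChartAt I x).target) (X : EG) :
    pullbackForm I (oneForm I β) (actionInCharts IG (G := G) I N x)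
      (actionChartDomain IG G (I := I) x) (extChartAt IG (1 : G) 1, y) ![((X, 0) : EG × E)] =
    β ((extChartAt I x).symm y) (fundamentalField IG I (G := G) X ((extChartAt I x).symm y)) := by
  have h1 : actionInCharts IG (G := G) I N x (extChartAt IG (1 : G) 1, y) =
      (extChartAt I x).symm y := by
    rw [actionInCharts, (extChartAt IG (1 : G)).left_inv (mem_extChartAt_source _), one_smul]
  refine form_apply_congr (oneForm I β) h1 (u := fun i => mfderivWithin 𝓘(ℝ, EG × E) I
    (actionInCharts IG (G := G) I N x) (actionChartDomain IG G (I := I) x)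
    (extChartAt IG (1 : G) 1, y) ((![((X, 0) : EG × E)] : Fin 1 → EG × E) i))
    (w := fun _ => fundamentalField IG I (G := G) X ((extChartAt I x).symm y)) ?_
  funext i
  have hi : i = 0 := Subsingleton.elim _ _
  subst hi
  exact mfderivWithin_actionInCharts_fst IG x hy X

/-- Cartan's formula for an invariant `1`-form. -/
theorem exteriorDerivative_oneForm_fundamentalField [IG.Boundaryless]
    {β : (x : N) → TangentSpace I x →L[ℝ] ℝ} (hβ : IsSmoothForm I (oneForm I β))
    (hinv : IsInvariantForm I G (oneForm I β)) (X : GroupLieAlgebra IG G) (x : N)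
    (u : TangentSpace I x) :
    exteriorDerivative I (oneForm I β) x ![fundamentalField IG I X x, u] =
      -mfderiv I 𝓘(ℝ, ℝ) (fun y => β y (fundamentalField IG I X y)) x u := by
  set S := actionChartDomain IG G (I := I) x with hSdef
  set P := actionInCharts IG (G := G) I N x with hPdef
  set B := pullbackForm I (oneForm I β) P S with hB
  set y₀ : E := extChartAt I x x with hy₀
  set h₀ : EG := extChartAt IG (1 : G) 1 with hh₀
  have hy : y₀ ∈ (extChartAt I x).target := mem_extChartAt_target x
  have hz : (h₀, y₀) ∈ S := ⟨mem_extChartAt_target _, hy⟩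
  have hx : (extChartAt I x).symm y₀ = x := (extChartAt I x).left_inv (mem_extChartAt_source x)
  have hP := contMDiffOn_actionInCharts IG (G := G) (I := I) x
  have hS := uniqueDiffOn_actionChartDomain IG (G := G) (I := I) x
  have hSc := actionChartDomain_subset_closure_interior IG (G := G) (I := I) x
  have hBd : DifferentiableWithinAt ℝ B S (h₀, y₀) :=
    hβ.differentiableWithinAt_pullbackForm hP hS hz
  set a : EG × E := ((X : EG), (0 : E)) with ha
  set b : EG × E := ((0 : EG), (u : E)) with hb
  have hPz : P (h₀, y₀) = x := by
    rw [hPdef, actionInCharts, hh₀, (extChartAt IG (1 : G)).left_inv (mem_extChartAt_source _),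
      one_smul, hx]
  have hl : exteriorDerivative I (oneForm I β) x ![fundamentalField IG I X x, u] =
      extDerivWithin B S (h₀, y₀) ![a, b] := by
    rw [hβ.extDerivWithin_pullbackForm hP hS hSc hz]
    refine (form_apply_congr (exteriorDerivative I (oneForm I β)) hPz ?_).symm
    funext i
    fin_cases i
    · refine (mfderivWithin_actionInCharts_fst IG (G := G) x hy X).trans ?_
      rw [hx]
      rfl
    · refine (mfderivWithin_actionInCharts_snd IG (G := G) x hz u).trans ?_
      have hf : (fun y => (extChartAt IG (1 : G)).symm h₀ • (extChartAt I x).symm y) =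
          (extChartAt I x).symm := by
        funext y
        rw [hh₀, (extChartAt IG (1 : G)).left_inv (mem_extChartAt_source _), one_smul]
      refine (congrArg (fun f => (mfderivWithin 𝓘(ℝ, E) I f (extChartAt I x).target y₀ (u : E) : E))
        hf).trans ?_
      have h1 := mfderivWithin_range_extChartAt_symm_apply (I := I) x u
      rwa [← mfderivWithin_extChartAt_symm_target x hy] at h1
  have h1 : fderivWithin ℝ (fun z => B z ![b]) S (h₀, y₀) a = 0 := by
    have hA : DifferentiableWithinAt ℝ (fun y => formInChart I (oneForm I β) x y ![(u : E)])
        (extChartAt I x).target y₀ :=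
      (((hβ x y₀ hy).differentiableWithinAt (by simp)).continuousAlternatingMap_apply_const _)
    have h2 : HasFDerivWithinAt (fun z : EG × E => formInChart I (oneForm I β) x z.2 ![(u : E)])
        _ S (h₀, y₀) :=
      HasFDerivWithinAt.comp (g := fun y => formInChart I (oneForm I β) x y ![(u : E)])
        (h₀, y₀) hA.hasFDerivWithinAt hasFDerivWithinAt_snd (fun z hz => hz.2)
    have h3 := (h2.congr (f₁ := fun z => B z ![b]) (fun z hz =>
      pullbackForm_actionInCharts_snd IG hinv x hz u)
      (pullbackForm_actionInCharts_snd IG hinv x hz u)).fderivWithin (hS _ hz)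
    rw [h3]
    simp [ha]
  have h2 : fderivWithin ℝ (fun z => B z ![a]) S (h₀, y₀) b =
      mfderiv I 𝓘(ℝ, ℝ) (fun y => β y (fundamentalField IG I X y)) x u := by
    have hd : DifferentiableWithinAt ℝ (fun z => B z ![a]) S (h₀, y₀) :=
      hBd.continuousAlternatingMap_apply_const _
    have hs : HasFDerivWithinAt (fun y => B (h₀, y) ![a])
        ((fderivWithin ℝ (fun z => B z ![a]) S (h₀, y₀)).comp (ContinuousLinearMap.inr ℝ EG E))
        (extChartAt I x).target y₀ :=
      hd.hasFDerivWithinAt.comp y₀ (hasFDerivAt_prodMk_right h₀ y₀).hasFDerivWithinAt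
        fun y hy => ⟨mem_extChartAt_target _, hy⟩
    have hs' := hs.congr (f₁ := fun y => β ((extChartAt I x).symm y)
      (fundamentalField IG I (G := G) X ((extChartAt I x).symm y)))
      (fun y hy => (pullbackForm_actionInCharts_fst IG β x hy X).symm)
      (pullbackForm_actionInCharts_fst IG β x hy X).symm
    have hs2 := (hs'.mono_of_mem_nhdsWithin
      (extChartAt_target_mem_nhdsWithin (I := I) x)).hasMFDerivWithinAt
    have h5 := HasMFDerivWithinAt.comp (I' := 𝓘(ℝ, E)) (s := univ) x (f := extChartAt I x) hs2
      ((mdifferentiableAt_extChartAt (mem_chart_source H x)).hasMFDerivAt.hasMFDerivWithinAt)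
      (fun _ _ => mem_range_self _)
    rw [hasMFDerivWithinAt_univ] at h5
    have h6 := (h5.congr_of_eventuallyEq
      (f₁ := fun y => β y (fundamentalField IG I (G := G) X y)) (by
      filter_upwards [extChartAt_source_mem_nhds (I := I) x] with y hy
      exact congrArg (fun z => β z (fundamentalField IG I (G := G) X z))
        ((extChartAt I x).left_inv hy).symm)).mfderiv
    have h7 : (mfderiv I 𝓘(ℝ, E) (extChartAt I x) x u : E) = u :=
      congrArg (fun L => L u) (mfderiv_extChartAt_self (I := I) (x := x))
    have h8 := congrArg (fun L => L u) h6
    refine Eq.trans ?_ h8.symm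
    exact congrArg (fun w : E => (fderivWithin ℝ (fun z => B z ![a]) S (h₀, y₀)) ((0 : EG), w))
      h7.symm
  rw [hl, extDerivWithin_apply hBd (hS _ hz), Fin.sum_univ_two]
  have e0 : Fin.removeNth (0 : Fin 2) ![a, b] = ![b] := by
    funext i
    rw [Subsingleton.elim i 0]
    rfl
  have e1 : Fin.removeNth (1 : Fin 2) ![a, b] = ![a] := by
    funext i
    rw [Subsingleton.elim i 0]
    rfl
  rw [e0, e1]
  simp only [Matrix.cons_val_zero, Matrix.cons_val_one, h1, h2, Fin.val_zero, Fin.val_one,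
    pow_zero, pow_one, smul_zero, zero_add]
  exact neg_one_zsmul (G := ℝ) _

end Cartan

end HamiltonianCompletion

end

noncomputable section

namespace HamiltonianCompletion

open Bundle

/-! ### Smooth sections of the tangent bundle and smooth forms -/

section Frames

variable {E : Type*} [NormedAddCommGroup E] [NormedSpace ℝ E]
  {H : Type*} [TopologicalSpace H] (I : ModelWithCorners ℝ E H)
  {N : Type*} [TopologicalSpace N] [ChartedSpace H N] [IsManifold I ∞ N]

/-- The coordinate vector field of the chart around `x₀` in the direction `a`. -/
def coordField (x₀ : N) (a : E) (x : N) : TangentSpace I x :=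
  (trivializationAt E (TangentSpace I : N → Type _) x₀).symmL ℝ x a

variable {I}

lemma coordField_eq_mfderivWithin (x₀ : N) (a : E) {x : N} (hx : x ∈ (chartAt H x₀).source) :
    (coordField I x₀ a x : E) =
      mfderivWithin 𝓘(ℝ, E) I (extChartAt I x₀).symm (range I) (extChartAt I x₀ x) a :=
  congrArg (fun L => L a) (TangentBundle.symmL_trivializationAt (I := I) hx)

lemma contMDiffAt_coordField (x₀ : N) (a : E) {x : N} (hx : x ∈ (chartAt H x₀).source) :
    ContMDiffAt I (I.prod 𝓘(ℝ, E)) ∞ (fun y => TotalSpace.mk' E y (coordField I x₀ a y)) x := by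
  have hx' : x ∈ (trivializationAt E (TangentSpace I : N → Type _) x₀).baseSet := by
    rwa [TangentBundle.trivializationAt_baseSet]
  rw [(trivializationAt E (TangentSpace I : N → Type _) x₀).contMDiffAt_section_iff hx']
  refine (contMDiffAt_const (c := a)).congr_of_eventuallyEq ?_
  filter_upwards [(trivializationAt E (TangentSpace I : N → Type _) x₀).open_baseSet.mem_nhds hx']
    with y hy
  rw [coordField, Trivialization.symmL_apply _ hy, Trivialization.apply_mk_symm _ hy]

lemma coordField_surjective (x₀ : N) {x : N} (hx : x ∈ (chartAt H x₀).source)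
    (u : TangentSpace I x) : ∃ a : E, coordField I x₀ a x = u := by
  have hx' : x ∈ (trivializationAt E (TangentSpace I : N → Type _) x₀).baseSet := by
    rwa [TangentBundle.trivializationAt_baseSet]
  exact ⟨_, (trivializationAt E (TangentSpace I : N → Type _) x₀).symmL_continuousLinearMapAt hx' u⟩

lemma formInChart_oneForm_apply (β : (x : N) → TangentSpace I x →L[ℝ] ℝ) (x₀ : N) {y : E}
    (hy : y ∈ (extChartAt I x₀).target) (a : E) :
    formInChart I (oneForm I β) x₀ y ![a] =
      β ((extChartAt I x₀).symm y) (coordField I x₀ a ((extChartAt I x₀).symm y)) := by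
  have hx : (extChartAt I x₀).symm y ∈ (chartAt H x₀).source := by
    have := (extChartAt I x₀).map_target hy
    rwa [extChartAt_source] at this
  have h := coordField_eq_mfderivWithin (I := I) x₀ a hx
  rw [(extChartAt I x₀).right_inv hy] at h
  exact congrArg (fun w : E => (β ((extChartAt I x₀).symm y) : E → ℝ) w) h.symm

theorem isSmoothForm_oneForm [FiniteDimensional ℝ E] {β : (x : N) → TangentSpace I x →L[ℝ] ℝ}
    (h : ∀ (x₀ x : N), x ∈ (chartAt H x₀).source → ∀ a : E,
      ContMDiffAt I 𝓘(ℝ, ℝ) ∞ (fun y => β y (coordField I x₀ a y)) x) :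
    IsSmoothForm I (oneForm I β) := by
  intro x₀
  let e := ContinuousAlternatingMap.ofSubsingletonLIE (𝕜 := ℝ) (E := E) (F := ℝ) (0 : Fin 1)
  let L : E → E →L[ℝ] ℝ := fun y => e.symm (formInChart I (oneForm I β) x₀ y)
  have hL : ContDiffOn ℝ ∞ L (extChartAt I x₀).target := by
    rw [contDiffOn_clm_apply]
    intro a y hy
    have hx : (extChartAt I x₀).symm y ∈ (chartAt H x₀).source := by
      have := (extChartAt I x₀).map_target hy
      rwa [extChartAt_source] at this
    have h1 := (h x₀ _ hx a).comp_contMDiffWithinAt y (contMDiffOn_extChartAt_symm x₀ y hy)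
    refine (h1.contDiffWithinAt).congr (fun z hz => ?_) ?_
    · exact formInChart_oneForm_apply β x₀ hz a
    · exact formInChart_oneForm_apply β x₀ hy a
  have h2 := e.contDiff (n := ∞).comp_contDiffOn hL
  refine h2.congr fun y _ => ?_
  exact (e.apply_symm_apply _).symm

/-- A smooth Riemannian metric evaluated on smooth vector fields along a map. -/
lemma contMDiffAt_metric_apply {E' H' M : Type*} [NormedAddCommGroup E'] [NormedSpace ℝ E']
    [TopologicalSpace H'] {J : ModelWithCorners ℝ E' H'} [TopologicalSpace M] [ChartedSpace H' M]
    (m : ContMDiffRiemannianMetric I ∞ E (TangentSpace I : N → Type _)) {b : M → N}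
    {V W : (p : M) → TangentSpace I (b p)} {p : M}
    (hV : ContMDiffAt J (I.prod 𝓘(ℝ, E)) ∞ (fun q => TotalSpace.mk' E (b q) (V q)) p)
    (hW : ContMDiffAt J (I.prod 𝓘(ℝ, E)) ∞ (fun q => TotalSpace.mk' E (b q) (W q)) p) :
    ContMDiffAt J 𝓘(ℝ, ℝ) ∞ (fun q => m.inner (b q) (V q) (W q)) p := by
  have hb : ContMDiffAt J I ∞ b p := (contMDiffAt_totalSpace.1 hV).1
  have h : ContMDiffAt J (I.prod 𝓘(ℝ)) ∞ (fun q => TotalSpace.mk' ℝ (E := Bundle.Trivial N ℝ)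
      (b q) (m.inner (b q) (V q) (W q))) p := by
    apply ContMDiffAt.clm_bundle_apply₂ (F₁ := E) (F₂ := E)
    · exact m.contMDiff.contMDiffAt.comp p hb
    · exact hV
    · exact hW
  exact (contMDiffAt_totalSpace.1 h).2

end Frames

section Actions

variable {EG : Type*} [NormedAddCommGroup EG] [NormedSpace ℝ EG]
  {HG : Type*} [TopologicalSpace HG] (IG : ModelWithCorners ℝ EG HG)
  {G : Type*} [TopologicalSpace G] [ChartedSpace HG G] [Group G] [LieGroup IG ∞ G]
  {E : Type*} [NormedAddCommGroup E] [NormedSpace ℝ E]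
  {H : Type*} [TopologicalSpace H] {I : ModelWithCorners ℝ E H}
  {N : Type*} [TopologicalSpace N] [ChartedSpace H N] [IsManifold I ∞ N]
  [MulAction G N] [ContMDiffSMul IG I ∞ G N]

omit [IsManifold I ∞ N] in
lemma totalSpace_mk_congr {x y : N} (h : x = y) (u : E) :
    TotalSpace.mk' (E := (TangentSpace I : N → Type _)) E x u =
      TotalSpace.mk' (E := (TangentSpace I : N → Type _)) E y u := by
  subst h; rfl

/-- The fundamental vector field of a smooth `𝔤`-valued function is smooth. -/
lemma contMDiff_fundamentalField {w : N → GroupLieAlgebra IG G}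
    (hw : ContMDiff (M' := EG) I 𝓘(ℝ, EG) ∞ w) :
    ContMDiff I (I.prod 𝓘(ℝ, E)) ∞
      (fun x => TotalSpace.mk' E x (fundamentalField IG I (w x) x)) := by
  intro x
  have h1 := ContMDiffAt.mfderiv (I := IG) (I' := I) (J := I) (m := ∞) (n := ∞) (x₀ := x)
    (fun (x : N) (g : G) => g • x) (fun _ => (1 : G))
    (ContMDiffAt.smul (I := IG) contMDiffAt_snd contMDiffAt_fst) contMDiffAt_const (by simp)
  have h2 : ContMDiffAt I (IG.prod 𝓘(ℝ, EG)) ∞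
      (fun y => (TotalSpace.mk' EG (1 : G) (w y) : TangentBundle IG G)) x := by
    rw [contMDiffAt_totalSpace]
    refine ⟨contMDiffAt_const, ?_⟩
    let L : EG →L[ℝ] EG :=
      (trivializationAt EG (TangentSpace IG : G → Type _) (1 : G)).continuousLinearMapAt ℝ (1 : G)
    refine ((L.contMDiff (n := ∞)).comp hw x).congr_of_eventuallyEq
      (Filter.Eventually.of_forall fun y => ?_)
    exact (congrFun (Trivialization.coe_linearMapAt_of_mem (R := ℝ)
      (trivializationAt EG (TangentSpace IG : G → Type _) (1 : G))
      (FiberBundle.mem_baseSet_trivializationAt' (1 : G))) (w y)).symm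
  have h3 := ContMDiffAt.clm_apply_of_inCoordinates (F₁ := EG) (F₂ := E)
    (E₁ := (TangentSpace IG : G → Type _)) (E₂ := (TangentSpace I : N → Type _))
    (b₁ := fun _ => (1 : G)) (b₂ := fun x : N => (1 : G) • x) (v := w)
    (ϕ := fun x : N => mfderiv IG I (fun g : G => g • x) 1) h1 h2
    (ContMDiffAt.smul (I := IG) contMDiffAt_const contMDiffAt_id)
  refine h3.congr_of_eventuallyEq (Filter.Eventually.of_forall fun y => ?_)
  exact totalSpace_mk_congr (one_smul G y).symm _

/-- The translates of the coordinate fields depend smoothly on the point and the group element. -/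
lemma contMDiffAt_mfderiv_smul_coordField (x₀ : N) (a : E) {p : N × G}
    (hp : p.1 ∈ (chartAt H x₀).source) :
    ContMDiffAt (I.prod IG) (I.prod 𝓘(ℝ, E)) ∞ (fun q : N × G => TotalSpace.mk' E (q.2 • q.1)
      (mfderiv I I (fun y : N => q.2 • y) q.1 (coordField I x₀ a q.1))) p := by
  have h1 := ContMDiffAt.mfderiv (I := I) (I' := I) (J := I.prod IG) (m := ∞) (n := ∞) (x₀ := p)
    (fun (q : N × G) (y : N) => q.2 • y) (fun q => q.1)
    (ContMDiffAt.smul (I := IG) (contMDiffAt_snd.comp _ contMDiffAt_fst) contMDiffAt_snd)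
    contMDiffAt_fst (by simp)
  have h2 : ContMDiffAt (I.prod IG) (I.prod 𝓘(ℝ, E)) ∞
      (fun q : N × G => TotalSpace.mk' E q.1 (coordField I x₀ a q.1)) p :=
    (contMDiffAt_coordField x₀ a hp).comp p contMDiffAt_fst
  exact ContMDiffAt.clm_apply_of_inCoordinates (F₁ := E) (F₂ := E)
    (E₁ := (TangentSpace I : N → Type _)) (E₂ := (TangentSpace I : N → Type _))
    (b₁ := fun q : N × G => q.1) (b₂ := fun q : N × G => q.2 • q.1)
    (v := fun q => coordField I x₀ a q.1)
    (ϕ := fun q : N × G => mfderiv I I (fun y : N => q.2 • y) q.1) h1 h2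
    (ContMDiffAt.smul (I := IG) contMDiffAt_snd contMDiffAt_fst)

end Actions

end HamiltonianCompletion

end

noncomputable section

namespace HamiltonianCompletion

open Bundle

/-! ### Equivariance of fundamental vector fields and the Bott projector -/

section Equivariance

variable {EG : Type*} [NormedAddCommGroup EG] [NormedSpace ℝ EG]
  {HG : Type*} [TopologicalSpace HG] (IG : ModelWithCorners ℝ EG HG)
  {G : Type*} [TopologicalSpace G] [ChartedSpace HG G] [Group G] [LieGroup IG ∞ G]
  {E : Type*} [NormedAddCommGroup E] [NormedSpace ℝ E]
  {H : Type*} [TopologicalSpace H] {I : ModelWithCorners ℝ E H}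
  {N : Type*} [TopologicalSpace N] [ChartedSpace H N]
  [MulAction G N]

omit [Group G] [LieGroup IG ∞ G] [MulAction G N] in
variable {IG} in
lemma mfderiv_apply_congr (F : G → N) {x y : G} (h : x = y) (w : EG) :
    (mfderiv IG I F x w : E) = mfderiv IG I F y w := by
  subst h; rfl

lemma mdifferentiableAt_conj (g h : G) : MDifferentiableAt IG IG (fun h : G => g * h * g⁻¹) h :=
  (((contMDiff_const (c := g)).mul contMDiff_id).mul
    (contMDiff_const (c := g⁻¹))).mdifferentiable (n := ∞) (by simp) h

omit [LieGroup IG ∞ G] in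
lemma mdifferentiableAt_smul_const [ContMDiffSMul IG I ∞ G N] (x : N) (h : G) :
    MDifferentiableAt IG I (fun h : G => h • x) h :=
  (ContMDiff.smul (I := IG) contMDiff_id (contMDiff_const (c := x))).mdifferentiable
    (n := ∞) (by simp) h

omit [LieGroup IG ∞ G] in
lemma mdifferentiableAt_const_smul [ContMDiffSMul IG I ∞ G N] (g : G) (x : N) :
    MDifferentiableAt I I (fun y : N => g • y) x :=
  (ContMDiff.smul (I := IG) (contMDiff_const (c := g)) contMDiff_id).mdifferentiable
    (n := ∞) (by simp) x

lemma fundamentalField_adjoint [ContMDiffSMul IG I ∞ G N] (g : G) (X : GroupLieAlgebra IG G)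
    (x : N) :
    fundamentalField IG I (adjoint IG g X) (g • x) =
      mfderiv I I (fun y : N => g • y) x (fundamentalField IG I X x) := by
  have e : (fun h : G => h • (g • x)) ∘ (fun h : G => g * h * g⁻¹) =
      (fun y : N => g • y) ∘ fun h : G => h • x := by
    funext h
    simp [mul_smul]
  have h1 := mfderiv_comp_of_eq (x := (1 : G)) (y := 1) (I := IG) (I' := IG) (I'' := I)
    (mdifferentiableAt_smul_const IG (I := I) (g • x) 1)
    (mdifferentiableAt_conj IG g 1) (by simp)
  have h2 := mfderiv_comp_of_eq (x := (1 : G)) (y := x) (I := IG) (I' := I) (I'' := I)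
    (mdifferentiableAt_const_smul IG (I := I) g x)
    (mdifferentiableAt_smul_const IG (I := I) x 1) (one_smul G x)
  have h3 := congrArg (fun F : G → N => (mfderiv IG I F 1 : EG →L[ℝ] E) X) e
  refine (mfderiv_apply_congr (fun h : G => h • (g • x)) (x := 1) (y := g * 1 * g⁻¹) (by simp) _).trans
    ((congrArg (fun L : EG →L[ℝ] E => L X) h1).symm.trans
    ((h3.trans (congrArg (fun L : EG →L[ℝ] E => L X) h2)).trans ?_))
  exact mfderiv_apply_congr (fun y : N => g • y) (one_smul G x) _

lemma adjoint_adjoint (g h : G) (X : GroupLieAlgebra IG G) :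
    adjoint IG g (adjoint IG h X) = adjoint IG (g * h) X := by
  have e : (fun k : G => g * k * g⁻¹) ∘ (fun k : G => h * k * h⁻¹) =
      fun k : G => (g * h) * k * (g * h)⁻¹ := by
    funext k
    simp [mul_assoc]
  have h1 := mfderiv_comp_of_eq (x := (1 : G)) (y := 1) (I := IG) (I' := IG) (I'' := IG)
    (mdifferentiableAt_conj IG g 1) (mdifferentiableAt_conj IG h 1) (by simp)
  have h3 := congrArg (fun F : G → G => (mfderiv IG IG F 1 : EG →L[ℝ] EG) X) e
  exact (mfderiv_apply_congr (fun k : G => g * k * g⁻¹) (x := 1) (y := h * 1 * h⁻¹) (by simp) _).trans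
    ((congrArg (fun L : EG →L[ℝ] EG => L X) h1).symm.trans h3)

omit [LieGroup IG ∞ G] in
lemma adjoint_one (X : GroupLieAlgebra IG G) : adjoint IG 1 X = X := by
  have e : (fun k : G => (1 : G) * k * 1⁻¹) = id := by
    funext k
    simp
  have h3 := congrArg (fun F : G → G => (mfderiv IG IG F 1 : EG →L[ℝ] EG) X) e
  exact h3.trans (congrArg (fun L : EG →L[ℝ] EG => L X) (mfderiv_id (I := IG) (x := (1 : G))))

lemma adjoint_inv_adjoint (g : G) (X : GroupLieAlgebra IG G) :
    adjoint IG g⁻¹ (adjoint IG g X) = X := by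
  rw [adjoint_adjoint, inv_mul_cancel, adjoint_one]

lemma adjoint_adjoint_inv (g : G) (X : GroupLieAlgebra IG G) :
    adjoint IG g (adjoint IG g⁻¹ X) = X := by
  rw [adjoint_adjoint, mul_inv_cancel, adjoint_one]

variable {IG}

lemma IsTamingMap.tamingField_smul [ContMDiffSMul IG I ∞ G N] {v : N → GroupLieAlgebra IG G}
    (hv : IsTamingMap IG I v) (g : G) (x : N) :
    tamingField IG I v (g • x) = mfderiv I I (fun y : N => g • y) x (tamingField IG I v x) := by
  rw [tamingField, hv.equivariant, fundamentalField_adjoint]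
  rfl

lemma IsHamiltonian.apply_tamingMap_smul {v : N → GroupLieAlgebra IG G}
    (hv : IsTamingMap IG I v) {σ : (x : N) → TangentSpace I x [⋀^Fin 2]→L[ℝ] ℝ}
    {Φ : N → (GroupLieAlgebra IG G →L[ℝ] ℝ)} (hσ : IsHamiltonian IG I σ Φ) (g : G) (x : N) :
    Φ (g • x) (v (g • x)) = Φ x (v x) := by
  rw [hσ.equivariant, hv.equivariant, adjoint_inv_adjoint]

omit [LieGroup IG ∞ G] in
lemma IsHamiltonian.contMDiff_apply_tamingMap [FiniteDimensional ℝ EG]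
    {v : N → GroupLieAlgebra IG G}
    (hv : IsTamingMap IG I v) {σ : (x : N) → TangentSpace I x [⋀^Fin 2]→L[ℝ] ℝ}
    {Φ : N → (GroupLieAlgebra IG G →L[ℝ] ℝ)} (hσ : IsHamiltonian IG I σ Φ) :
    ContMDiff I 𝓘(ℝ, ℝ) ∞ (fun x => Φ x (v x)) := by
  let b := Module.finBasis ℝ EG
  have e : (fun x => Φ x (v x)) = fun x => ∑ i, (b.coord i (v x)) * Φ x (b i : EG) := by
    funext x
    let L : EG →L[ℝ] ℝ := Φ x
    let w : EG := v x
    have h : L w = ∑ i, b.coord i w * L (b i) := by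
      conv_lhs => rw [← b.sum_repr w, map_sum]
      simp only [map_smul, smul_eq_mul, Module.Basis.coord_apply]
    exact h
  rw [e]
  refine ContMDiff.sum fun i _ => ?_
  have h1 : ContMDiff I 𝓘(ℝ, ℝ) ∞ (fun x => b.coord i (v x)) :=
    ((LinearMap.toContinuousLinearMap (b.coord i)).contMDiff).comp hv.smooth
  exact h1.mul (hσ.smooth_map (b i : EG))

end Equivariance

section Bott

variable {E : Type*} [NormedAddCommGroup E] [NormedSpace ℝ E]
  {H : Type*} [TopologicalSpace H] {I : ModelWithCorners ℝ E H}
  {N : Type*} [TopologicalSpace N] [ChartedSpace H N] [IsManifold I ∞ N]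
  {m : ContMDiffRiemannianMetric I ∞ E (TangentSpace I : N → Type _)}
  {V : (x : N) → TangentSpace I x}

lemma bottProjector_self {x : N} (hx : V x ≠ 0) : bottProjector I m V x (V x) = 1 := by
  have h := (m.pos x (V x) hx).ne'
  exact inv_mul_cancel₀ h

lemma bottProjector_smul {G : Type*} [Group G] [MulAction G N] (hm : IsInvariantMetric I G m)
    {g : G} {x : N} (hV : V (g • x) = mfderiv I I (fun y : N => g • y) x (V x))
    (u : TangentSpace I x) :
    bottProjector I m V (g • x) (mfderiv I I (fun y : N => g • y) x u) =
      bottProjector I m V x u := by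
  change (m.inner (g • x) (V (g • x)) (V (g • x)))⁻¹ * m.inner (g • x) (V (g • x)) _ =
    (m.inner x (V x) (V x))⁻¹ * m.inner x (V x) u
  rw [hV, hm, hm]

/-- The product of the Bott projector of `V` with a function that vanishes near the zeros of `V`
is smooth. -/
lemma contMDiffAt_smul_bottProjector_apply
    (hV : ContMDiff I (I.prod 𝓘(ℝ, E)) ∞ fun x => TotalSpace.mk' E x (V x))
    {h : N → ℝ} (hh : ContMDiff I 𝓘(ℝ, ℝ) ∞ h) (hz : ∀ x, V x = 0 → h =ᶠ[𝓝 x] 0)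
    {W : (x : N) → TangentSpace I x} {x : N}
    (hW : ContMDiffAt I (I.prod 𝓘(ℝ, E)) ∞ (fun x => TotalSpace.mk' E x (W x)) x) :
    ContMDiffAt I 𝓘(ℝ, ℝ) ∞ (fun y => (h y • bottProjector I m V y) (W y)) x := by
  change ContMDiffAt I 𝓘(ℝ, ℝ) ∞
    (fun y => h y * ((m.inner y (V y) (V y))⁻¹ * m.inner y (V y) (W y))) x
  by_cases hx : V x = 0
  · refine (contMDiffAt_const (c := (0 : ℝ))).congr_of_eventuallyEq ?_
    filter_upwards [hz x hx] with y hy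
    simp [hy]
  · have h1 := contMDiffAt_metric_apply m (b := id) (hV x) (hV x)
    have h2 := contMDiffAt_metric_apply m (b := id) (hV x) hW
    exact (hh x).mul ((h1.inv₀ (m.pos x (V x) hx).ne').mul h2)

end Bott

end HamiltonianCompletion

end

noncomputable section

namespace HamiltonianCompletion

open Bundle MeasureTheory

/-! ### Invariant Riemannian metrics -/

section Metric

variable {E : Type*} [NormedAddCommGroup E] [NormedSpace ℝ E] [FiniteDimensional ℝ E]

lemma isVonNBounded_of_pos (B : E →L[ℝ] E →L[ℝ] ℝ) (hpos : ∀ v, v ≠ 0 → 0 < B v v) :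
    Bornology.IsVonNBounded ℝ {v : E | B v v < 1} := by
  rw [NormedSpace.isVonNBounded_iff]
  rcases subsingleton_or_nontrivial E with hE | hE
  · exact (Set.toFinite _).isBounded
  have hc : Continuous fun v : E => B v v := by fun_prop
  obtain ⟨w, hw, hmin⟩ := (isCompact_sphere (0 : E) 1).exists_isMinOn
    (NormedSpace.sphere_nonempty.2 zero_le_one) hc.continuousOn
  have hw0 : w ≠ 0 := by
    rintro rfl
    simp at hw
  have hδ := hpos w hw0
  refine (Metric.isBounded_closedBall (x := (0 : E)) (r := max 1 (B w w)⁻¹)).subset fun v hv => ?_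
  rw [mem_closedBall_zero_iff]
  by_contra! hlt
  have h1 : 1 < ‖v‖ := (le_max_left _ _).trans_lt hlt
  have h2 : (B w w)⁻¹ < ‖v‖ := (le_max_right _ _).trans_lt hlt
  have hv0 : ‖v‖ ≠ 0 := by positivity
  have hs : (‖v‖⁻¹ • v) ∈ Metric.sphere (0 : E) 1 := by
    simp [norm_smul, hv0]
  have h3 : B w w ≤ B (‖v‖⁻¹ • v) (‖v‖⁻¹ • v) := hmin hs
  simp only [map_smul, _root_.smul_apply, smul_eq_mul] at h3
  have hv1 : B v v < 1 := hv
  have h4 : B w w * ‖v‖ ^ 2 ≤ B v v := by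
    calc B w w * ‖v‖ ^ 2 ≤ (‖v‖⁻¹ * (‖v‖⁻¹ * B v v)) * ‖v‖ ^ 2 := by gcongr
      _ = B v v := by field_simp
  have h5 : 1 < B w w * ‖v‖ := by
    rwa [inv_lt_iff_one_lt_mul₀' hδ] at h2
  nlinarith

variable {H : Type*} [TopologicalSpace H] {I : ModelWithCorners ℝ E H}
  {N : Type*} [TopologicalSpace N] [ChartedSpace H N]

lemma contMDiffAt_clm {F : Type*} [NormedAddCommGroup F] [NormedSpace ℝ F]
    {E' : Type*} [NormedAddCommGroup E'] [NormedSpace ℝ E']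
    {H' : Type*} [TopologicalSpace H'] {J : ModelWithCorners ℝ E' H'}
    {M : Type*} [TopologicalSpace M] [ChartedSpace H' M] {f : M → E →L[ℝ] F} {x : M}
    (h : ∀ a, ContMDiffAt J 𝓘(ℝ, F) ∞ (fun y => f y a) x) :
    ContMDiffAt J 𝓘(ℝ, E →L[ℝ] F) ∞ f x := by
  let b := Module.finBasis ℝ E
  have e : f = fun y => ∑ i, ContinuousLinearMap.smulRightL ℝ E F
      (LinearMap.toContinuousLinearMap (b.coord i)) (f y (b i)) := by
    funext y
    ext a
    conv_lhs => rw [← b.sum_repr a, map_sum]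
    simp
  rw [e]
  exact ContMDiffAt.sum fun i _ => (ContinuousLinearMap.contMDiff _).contMDiffAt.comp x (h (b i))

variable [IsManifold I ∞ N]

set_option synthInstance.maxHeartbeats 400000 in
/-- A family of bilinear forms on the tangent spaces is smooth if its coefficients with respect to
coordinate fields are. -/
lemma contMDiffAt_bilinearForm (B : (x : N) → TangentSpace I x →L[ℝ] TangentSpace I x →L[ℝ] ℝ)
    (x₀ : N) {x : N} (hx : x ∈ (chartAt H x₀).source)
    (h : ∀ a b : E, ContMDiffAt I 𝓘(ℝ, ℝ) ∞
      (fun y => B y (coordField I x₀ a y) (coordField I x₀ b y)) x) :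
    ContMDiffAt I (I.prod 𝓘(ℝ, E →L[ℝ] E →L[ℝ] ℝ)) ∞
      (fun y => TotalSpace.mk' (E →L[ℝ] E →L[ℝ] ℝ) y (B y)) x := by
  have hx' : x ∈ (trivializationAt E (TangentSpace I : N → Type _) x₀).baseSet := by
    rwa [TangentBundle.trivializationAt_baseSet]
  have hmem : x ∈ (trivializationAt (E →L[ℝ] E →L[ℝ] ℝ)
      (fun x : N => TangentSpace I x →L[ℝ] TangentSpace I x →L[ℝ] ℝ) x₀).baseSet :=
    ⟨hx', hx', mem_univ _⟩
  refine (Trivialization.contMDiffAt_section_iff (trivializationAt (E →L[ℝ] E →L[ℝ] ℝ)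
      (fun x : N => TangentSpace I x →L[ℝ] TangentSpace I x →L[ℝ] ℝ) x₀) hmem).2 ?_
  refine contMDiffAt_clm fun a => contMDiffAt_clm fun b => ?_
  refine (h a b).congr_of_eventuallyEq ?_
  filter_upwards [(trivializationAt E (TangentSpace I : N → Type _) x₀).open_baseSet.mem_nhds hx']
    with y hy
  refine (inCoordinates_apply_eq₂ (𝕜 := ℝ) (E₁ := (TangentSpace I : N → Type _))
    (E₂ := (TangentSpace I : N → Type _)) (E₃ := fun _ : N => ℝ) hy hy (mem_univ _)).trans ?_
  simp [coordField, Trivialization.symmL_apply _ hy]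

/-- A smooth family of symmetric positive definite bilinear forms, as a Riemannian metric. -/
def metricOfBilinearForm (B : (x : N) → TangentSpace I x →L[ℝ] TangentSpace I x →L[ℝ] ℝ)
    (hsymm : ∀ x u w, B x u w = B x w u) (hpos : ∀ x u, u ≠ 0 → 0 < B x u u)
    (hB : ContMDiff I (I.prod 𝓘(ℝ, E →L[ℝ] E →L[ℝ] ℝ)) ∞
      (fun y => TotalSpace.mk' (E →L[ℝ] E →L[ℝ] ℝ) y (B y))) :
    ContMDiffRiemannianMetric I ∞ E (TangentSpace I : N → Type _) where
  inner := B
  symm := hsymm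
  pos := hpos
  isVonNBounded x := isVonNBounded_of_pos (E := E) (B x) (hpos x)
  contMDiff := hB

/-- In the domain of a chart there is a smooth family of inner products on tangent spaces. -/
lemma exists_local_bilinearForm (x₀ : N) :
    ∃ B : (x : N) → TangentSpace I x →L[ℝ] TangentSpace I x →L[ℝ] ℝ,
      ContMDiffOn I (I.prod 𝓘(ℝ, E →L[ℝ] E →L[ℝ] ℝ)) ∞
        (fun y => TotalSpace.mk' (E →L[ℝ] E →L[ℝ] ℝ) y (B y)) (chartAt H x₀).source ∧
      ∀ x ∈ (chartAt H x₀).source, (∀ u w, B x u w = B x w u) ∧ ∀ u, u ≠ 0 → 0 < B x u u := by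
  let e := trivializationAt E (TangentSpace I : N → Type _) x₀
  let T : E ≃L[ℝ] EuclideanSpace ℝ (Fin (Module.finrank ℝ E)) := toEuclidean
  let B₀ : E →L[ℝ] E →L[ℝ] ℝ :=
    (innerSL ℝ (E := EuclideanSpace ℝ (Fin (Module.finrank ℝ E)))).bilinearComp
      T.toContinuousLinearMap T.toContinuousLinearMap
  have hB₀ : ∀ u w, B₀ u w = inner ℝ (T u) (T w) := fun _ _ => rfl
  let L : N → E →L[ℝ] E := fun y => e.continuousLinearMapAt ℝ y
  let B : N → E →L[ℝ] E →L[ℝ] ℝ := fun y => B₀.bilinearComp (L y) (L y)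
  have hBL : ∀ y (u w : E), B y u w = B₀ (L y u) (L y w) := fun _ _ _ => rfl
  have hsrc : ∀ y, y ∈ (chartAt H x₀).source → y ∈ e.baseSet := fun y hy => by
    rwa [TangentBundle.trivializationAt_baseSet]
  refine ⟨B, fun y hy => ?_, fun y hy => ⟨fun u w => ?_, fun u hu => ?_⟩⟩
  · refine (contMDiffAt_bilinearForm B x₀ hy fun a b => ?_).contMDiffWithinAt
    refine (contMDiffAt_const (c := B₀ a b)).congr_of_eventuallyEq ?_
    filter_upwards [(chartAt H x₀).open_source.mem_nhds hy] with z hz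
    refine (hBL z _ _).trans ?_
    have h : ∀ c : E, L z (coordField I x₀ c z) = c :=
      fun c => e.continuousLinearMapAt_symmL (hsrc z hz) c
    rw [h, h]
  · refine (hBL y u w).trans (Eq.trans ?_ (hBL y w u).symm)
    rw [hB₀, hB₀, real_inner_comm]
  · refine lt_of_lt_of_eq ?_ (hBL y u u).symm
    rw [hB₀]
    have hu' : L y u ≠ 0 := fun h0 => hu <| by
      have h1 := e.symmL_continuousLinearMapAt (R := ℝ) (hsrc y hy) u
      have h2 : e.continuousLinearMapAt ℝ y u = 0 := h0
      rw [h2, map_zero] at h1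
      exact h1.symm
    exact real_inner_self_pos.2 (by simpa using hu')

set_option synthInstance.maxHeartbeats 400000 in
set_option maxHeartbeats 1000000 in
variable (I N) in
theorem nonempty_riemannianMetric [T2Space N] [SigmaCompactSpace N] :
    Nonempty (ContMDiffRiemannianMetric I ∞ E (TangentSpace I : N → Type _)) := by
  let t : (x : N) → Set (TangentSpace I x →L[ℝ] TangentSpace I x →L[ℝ] ℝ) := fun x =>
    {B | (∀ u w, B u w = B w u) ∧ ∀ u, u ≠ 0 → 0 < B u u}
  have ht : ∀ x, Convex ℝ (t x) := by
    rintro x B ⟨hB, hB'⟩ C ⟨hC, hC'⟩ r s hr hs hrs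
    refine ⟨fun u w => ?_, fun u hu => ?_⟩
    · change r * B u w + s * C u w = r * B w u + s * C w u
      rw [hB, hC]
    · change 0 < r * B u u + s * C u u
      have h1 := hB' u hu
      have h2 := hC' u hu
      rcases hr.eq_or_lt with rfl | hr
      · have : s = 1 := by linarith
        simpa [this] using h2
      · positivity
  obtain ⟨s, hs⟩ := exists_contMDiffSection_forall_mem_convex_of_local (n := ⊤) I
    (F_fiber := E →L[ℝ] E →L[ℝ] ℝ)
    (fun x : N => TangentSpace I x →L[ℝ] TangentSpace I x →L[ℝ] ℝ) t ht (fun x₀ => by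
      obtain ⟨B, hB, hB'⟩ := exists_local_bilinearForm (I := I) x₀
      exact ⟨(chartAt H x₀).source, chart_source_mem_nhds H x₀, B, hB, hB'⟩)
  exact ⟨metricOfBilinearForm (fun x => s x) (fun x => (hs x).1) (fun x => (hs x).2) s.contMDiff⟩

end Metric

end HamiltonianCompletion

end

noncomputable section

namespace HamiltonianCompletion

open Bundle MeasureTheory

/-! ### Averaging over a compact group -/

section Average

lemma exists_isMulRightInvariant_probabilityMeasure (G : Type*) [Group G] [TopologicalSpace G]
    [IsTopologicalGroup G] [CompactSpace G] [MeasurableSpace G] [BorelSpace G] :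
    ∃ μ : Measure G, IsProbabilityMeasure μ ∧ μ.IsMulRightInvariant := by
  let ν : Measure G := Measure.haarMeasure ⊤
  have hν : IsProbabilityMeasure ν := ⟨Measure.haarMeasure_self⟩
  refine ⟨ν.inv, ⟨?_⟩, inferInstance⟩
  rw [Measure.inv_apply, inv_univ, measure_univ]

lemma integral_pos_of_continuous {G : Type*} [TopologicalSpace G] [CompactSpace G]
    [MeasurableSpace G] [BorelSpace G] (μ : Measure G) [IsProbabilityMeasure μ] {f : G → ℝ}
    (hf : Continuous f) (hpos : ∀ g, 0 < f g) : 0 < ∫ g, f g ∂μ := by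
  rw [integral_pos_iff_support_of_nonneg (fun g => (hpos g).le) (integrable_of_continuous μ hf)]
  have : Function.support f = univ := eq_univ_of_forall fun g => (hpos g).ne'
  simp [this]

lemma integral_clm_apply {G E V : Type*} [TopologicalSpace G] [CompactSpace G]
    [MeasurableSpace G] [BorelSpace G] (μ : Measure G) [IsProbabilityMeasure μ]
    [NormedAddCommGroup E] [NormedSpace ℝ E] [NormedAddCommGroup V] [NormedSpace ℝ V]
    {F : G → E →L[ℝ] V} (hF : Continuous F) (u : E) :
    (∫ g, F g ∂μ) u = ∫ g, F g u ∂μ :=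
  ContinuousLinearMap.integral_apply (integrable_of_continuous μ hF) u

variable {EG : Type*} [NormedAddCommGroup EG] [NormedSpace ℝ EG]
  {HG : Type*} [TopologicalSpace HG] (IG : ModelWithCorners ℝ EG HG)
  {G : Type*} [TopologicalSpace G] [ChartedSpace HG G] [Group G] [LieGroup IG ∞ G]
  [CompactSpace G] [MeasurableSpace G] [BorelSpace G]
  (μ : Measure G) [IsProbabilityMeasure μ]
  {E : Type*} [NormedAddCommGroup E] [NormedSpace ℝ E]
  {H : Type*} [TopologicalSpace H] {I : ModelWithCorners ℝ E H}
  {N : Type*} [TopologicalSpace N] [ChartedSpace H N] [IsManifold I ∞ N]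
  [MulAction G N] [ContMDiffSMul IG I ∞ G N]

include IG in
lemma contMDiff_average {f : N → ℝ} (hf : ContMDiff I 𝓘(ℝ, ℝ) ∞ f) :
    ContMDiff I 𝓘(ℝ, ℝ) ∞ (fun x => ∫ g : G, f (g • x) ∂μ) := by
  rw [← contMDiffOn_univ]
  refine contMDiffOn_integral_of_compactSpace IG μ I isOpen_univ (F := fun x g => f (g • x)) ?_
  exact (hf.comp (ContMDiff.smul (I := IG) contMDiff_snd contMDiff_fst)).contMDiffOn

omit [LieGroup IG ∞ G] [CompactSpace G] [IsProbabilityMeasure μ] [IsManifold I ∞ N]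
  [TopologicalSpace N] [ChartedSpace H N] [ContMDiffSMul IG I ∞ G N] in
lemma average_smul [IsTopologicalGroup G] [μ.IsMulRightInvariant] (f : N → ℝ) (h : G) (x : N) :
    ∫ g : G, f (g • h • x) ∂μ = ∫ g : G, f (g • x) ∂μ := by
  simp_rw [smul_smul]
  exact integral_mul_right_eq_self (μ := μ) (fun g : G => f (g • x)) h

variable (m : ContMDiffRiemannianMetric I ∞ E (TangentSpace I : N → Type _))

include IG in
omit [CompactSpace G] [MeasurableSpace G] [BorelSpace G] in
lemma contMDiffOn_metric_smul (x₀ : N) (a b : E) :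
    ContMDiffOn (I.prod IG) 𝓘(ℝ, ℝ) ∞ (Function.uncurry fun (x : N) (g : G) => m.inner (g • x)
      (mfderiv I I (fun y : N => g • y) x (coordField I x₀ a x))
      (mfderiv I I (fun y : N => g • y) x (coordField I x₀ b x)))
      ((chartAt H x₀).source ×ˢ univ) := by
  rintro ⟨x, g⟩ ⟨hx, -⟩
  exact (contMDiffAt_metric_apply m (J := I.prod IG) (b := fun q : N × G => q.2 • q.1)
    (contMDiffAt_mfderiv_smul_coordField IG x₀ a hx)
    (contMDiffAt_mfderiv_smul_coordField IG x₀ b hx)).contMDiffWithinAt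

include IG in
omit [CompactSpace G] [MeasurableSpace G] [BorelSpace G] in
lemma continuous_metric_smul (x : N) (u w : TangentSpace I x) :
    Continuous fun g : G => m.inner (g • x) (mfderiv I I (fun y : N => g • y) x u)
      (mfderiv I I (fun y : N => g • y) x w) := by
  obtain ⟨a, rfl⟩ := coordField_surjective (I := I) x (mem_chart_source H x) u
  obtain ⟨b, rfl⟩ := coordField_surjective (I := I) x (mem_chart_source H x) w
  have h := (contMDiffOn_metric_smul IG (G := G) m x a b).continuousOn
  exact h.comp_continuous (f := fun g : G => (x, g)) (by fun_prop)
    fun g => ⟨mem_chart_source H x, mem_univ _⟩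

variable [FiniteDimensional ℝ E]

/-- The pullback of a bilinear form under a linear map. -/
def pullbackBilinearForm (B : E →L[ℝ] E →L[ℝ] ℝ) (D : E →L[ℝ] E) : E →L[ℝ] E →L[ℝ] ℝ :=
  B.bilinearComp D D

/-- The average over the group of the pullbacks of a metric. -/
def averageBilinearForm (x : N) : TangentSpace I x →L[ℝ] TangentSpace I x →L[ℝ] ℝ :=
  (∫ g : G, pullbackBilinearForm (E := E) (m.inner (g • x))
    (mfderiv I I (fun y : N => g • y) x) ∂μ : E →L[ℝ] E →L[ℝ] ℝ)

include IG in
lemma averageBilinearForm_apply (x : N) (u w : TangentSpace I x) :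
    averageBilinearForm μ m x u w = ∫ g : G, m.inner (g • x)
      (mfderiv I I (fun y : N => g • y) x u) (mfderiv I I (fun y : N => g • y) x w) ∂μ := by
  let F : G → E →L[ℝ] E →L[ℝ] ℝ := fun g => pullbackBilinearForm (E := E) (m.inner (g • x))
    (mfderiv I I (fun y : N => g • y) x)
  have hc : Continuous F :=
    continuous_clm_apply.2 fun u => continuous_clm_apply.2 fun w =>
      continuous_metric_smul IG m x u w
  have h : ∀ u w : E, (∫ g : G, F g ∂μ) u w = ∫ g : G, F g u w ∂μ := fun u w =>
    (congrArg (fun L : E →L[ℝ] ℝ => L w) (integral_clm_apply μ hc u)).trans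
      (integral_clm_apply μ (hc.clm_apply continuous_const) w)
  exact h u w

include IG in
lemma contMDiff_averageBilinearForm :
    ContMDiff I (I.prod 𝓘(ℝ, E →L[ℝ] E →L[ℝ] ℝ)) ∞
      (fun y => TotalSpace.mk' (E →L[ℝ] E →L[ℝ] ℝ)
        (E := fun x : N => TangentSpace I x →L[ℝ] TangentSpace I x →L[ℝ] ℝ)
        y (averageBilinearForm μ m y)) := by
  intro x
  refine contMDiffAt_bilinearForm (averageBilinearForm μ m) x (mem_chart_source H x)
    fun a b => ?_
  have h := contMDiffOn_integral_of_compactSpace IG μ I (chartAt H x).open_source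
    (contMDiffOn_metric_smul IG (G := G) m x a b)
  refine (h.contMDiffAt (chart_source_mem_nhds H x)).congr_of_eventuallyEq ?_
  exact Filter.Eventually.of_forall fun y => averageBilinearForm_apply IG μ m y _ _

variable (I N G) in
include IG in
omit [MeasurableSpace G] [BorelSpace G] in
/-- A compact group acts by isometries of some Riemannian metric. -/
theorem exists_isInvariantMetric [T2Space N] [SigmaCompactSpace N] :
    ∃ m : ContMDiffRiemannianMetric I ∞ E (TangentSpace I : N → Type _),
      IsInvariantMetric I G m := by
  have : IsTopologicalGroup G := topologicalGroup_of_lieGroup IG ∞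
  borelize G
  obtain ⟨μ, hμ, hμ'⟩ := exists_isMulRightInvariant_probabilityMeasure G
  obtain ⟨m⟩ := nonempty_riemannianMetric I N
  have happ := averageBilinearForm_apply IG μ m
  have hd : ∀ (g : G) (x : N), MDifferentiableAt I I (fun y : N => g • y) x :=
    mdifferentiableAt_const_smul IG
  refine ⟨metricOfBilinearForm (averageBilinearForm μ m) (fun x u w => ?_) (fun x u hu => ?_)
    (contMDiff_averageBilinearForm IG μ m), fun h x u w => ?_⟩
  · refine (happ x u w).trans (Eq.trans ?_ (happ x w u).symm)
    exact integral_congr_ae (Filter.Eventually.of_forall fun g => m.symm _ _ _)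
  · refine lt_of_lt_of_eq ?_ (happ x u u).symm
    refine integral_pos_of_continuous μ (continuous_metric_smul IG m x u u) fun g => ?_
    refine m.pos _ _ fun h0 => hu ?_
    have e : (fun y : N => g⁻¹ • y) ∘ (fun y : N => g • y) = id := by
      funext y
      simp
    have h1 := mfderiv_comp (I := I) (I' := I) (I'' := I) x (hd g⁻¹ (g • x)) (hd g x)
    have h2 := congrArg (fun F : N → N => (mfderiv I I F x : E →L[ℝ] E) u) e
    have h3 := (congrArg (fun L : E →L[ℝ] E => L u) h1).symm.trans h2
    have h4 := (h3.trans (congrArg (fun L : E →L[ℝ] E => L u) (mfderiv_id (I := I) (x := x)))).symm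
    refine h4.trans ?_
    exact (congrArg (fun w : E => (mfderiv I I (fun y : N => g⁻¹ • y) (g • x) : E →L[ℝ] E) w)
      h0).trans (map_zero _)
  · refine (happ (h • x) _ _).trans (Eq.trans ?_ (happ x u w).symm)
    rw [← integral_mul_right_eq_self (μ := μ) (fun g : G => m.inner (g • x)
      (mfderiv I I (fun y : N => g • y) x u) (mfderiv I I (fun y : N => g • y) x w)) h]
    refine integral_congr_ae (Filter.Eventually.of_forall fun g => ?_)
    have h1 := mfderiv_comp (I := I) (I' := I) (I'' := I) x (hd g (h • x)) (hd h x)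
    have e : (fun y : N => g • y) ∘ (fun y : N => h • y) = fun y => (g * h) • y := by
      funext y
      simp [mul_smul]
    have h2 : ∀ z : E, (mfderiv I I (fun y : N => (g * h) • y) x : E →L[ℝ] E) z =
        (mfderiv I I (fun y : N => g • y) (h • x) : E →L[ℝ] E)
          ((mfderiv I I (fun y : N => h • y) x : E →L[ℝ] E) z) := fun z =>
      (congrArg (fun F : N → N => (mfderiv I I F x : E →L[ℝ] E) z) e).symm.trans
        (congrArg (fun L : E →L[ℝ] E => L z) h1)
    have h3 : ∀ (z z' : N) (_ : z = z') (p p' q q' : E), p = p' → q = q' →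
        (m.inner z : E →L[ℝ] E →L[ℝ] ℝ) p q = (m.inner z' : E →L[ℝ] E →L[ℝ] ℝ) p' q' := by
      rintro z _ rfl p _ q _ rfl rfl
      rfl
    exact h3 _ _ (mul_smul g h x).symm _ _ _ _ (h2 u).symm (h2 w).symm

end Average

end HamiltonianCompletion

end

noncomputable section

namespace HamiltonianCompletion

open MeasureTheory

/-! ### Proper invariant functions -/

section Proper

variable {E : Type*} [NormedAddCommGroup E] [NormedSpace ℝ E] [FiniteDimensional ℝ E]
  {H : Type*} [TopologicalSpace H] {I : ModelWithCorners ℝ E H}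
  {N : Type*} [TopologicalSpace N] [ChartedSpace H N]

variable (I N) in
lemma exists_contMDiff_isCompact_sublevel [IsManifold I ∞ N] [T2Space N] [SigmaCompactSpace N] :
    ∃ g : N → ℝ, ContMDiff I 𝓘(ℝ, ℝ) ∞ g ∧ (∀ x, 0 ≤ g x) ∧ ∀ c, IsCompact {x | g x ≤ c} := by
  have : LocallyCompactSpace N := Manifold.locallyCompact_of_finiteDimensional I
  let K := CompactExhaustion.choice N
  obtain ⟨g, hg⟩ := exists_contMDiffMap_forall_mem_convex_of_local_const (n := ⊤) I
    (t := fun x => {c : ℝ | 0 ≤ c ∧ ∀ n : ℕ, x ∉ K n → n ≤ c})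
    (fun x c hc d hd r s hr hs hrs => by
      refine ⟨by have := hc.1; have := hd.1; change 0 ≤ r * c + s * d; positivity,
        fun n hn => ?_⟩
      have h1 := hc.2 n hn
      have h2 := hd.2 n hn
      change (n : ℝ) ≤ r * c + s * d
      calc (n : ℝ) = r * n + s * n := by rw [← add_mul, hrs, one_mul]
        _ ≤ r * c + s * d := by gcongr)
    (fun x => by
      obtain ⟨n, hn⟩ := K.exists_mem x
      refine ⟨((n + 1 : ℕ) : ℝ), ?_⟩
      filter_upwards [isOpen_interior.mem_nhds (K.subset_interior_succ n hn)] with y hy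
      refine ⟨by positivity, fun k hk => ?_⟩
      by_contra! h
      exact hk (K.subset (by exact_mod_cast h.le) (interior_subset hy)))
  refine ⟨g, g.contMDiff, fun x => (hg x).1, fun c => ?_⟩
  obtain ⟨n, hn⟩ := exists_nat_gt c
  refine (K.isCompact n).of_isClosed_subset
    (isClosed_le g.contMDiff.continuous continuous_const) fun x hx => ?_
  by_contra h
  exact (((hg x).2 n h).trans hx).not_gt hn

variable {EG : Type*} [NormedAddCommGroup EG] [NormedSpace ℝ EG]
  {HG : Type*} [TopologicalSpace HG] (IG : ModelWithCorners ℝ EG HG)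
  {G : Type*} [TopologicalSpace G] [ChartedSpace HG G] [Group G] [LieGroup IG ∞ G]
  [CompactSpace G] [MulAction G N]

omit [ChartedSpace H N] [ChartedSpace HG G] [LieGroup IG ∞ G] [CompactSpace G] in
lemma isCompact_setOf_exists_smul_mem [CompactSpace G] [ContinuousSMul G N] [ContinuousInv G]
    {K : Set N} (hK : IsCompact K) : IsCompact {x | ∃ g : G, g • x ∈ K} := by
  have h := ((isCompact_univ (X := G)).prod hK).image
    (f := fun p : G × N => p.1⁻¹ • p.2) (by fun_prop)
  convert h using 1
  ext x
  constructor
  · rintro ⟨g, hg⟩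
    exact ⟨(g, g • x), ⟨mem_univ _, hg⟩, inv_smul_smul g x⟩
  · rintro ⟨⟨g, y⟩, ⟨-, hy⟩, rfl⟩
    exact ⟨g, by simpa using hy⟩

omit [ChartedSpace H N] [ChartedSpace HG G] [LieGroup IG ∞ G] in
lemma isOpen_setOf_forall_smul_mem [ContinuousSMul G N] {U : Set N} (hU : IsOpen U) :
    IsOpen {x | ∀ g : G, g • x ∈ U} := by
  have hc : IsClosed {p : G × N | p.1 • p.2 ∉ U} :=
    hU.isClosed_compl.preimage (by fun_prop : Continuous fun p : G × N => p.1 • p.2)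
  have h := isClosedMap_snd_of_compactSpace _ hc
  convert h.isOpen_compl using 1
  ext x
  simp

variable [IsManifold I ∞ N] [T2Space N] [SigmaCompactSpace N] [ContMDiffSMul IG I ∞ G N]

variable (I N) (G) in
include IG in
lemma exists_invariant_isCompact_sublevel :
    ∃ ρ : N → ℝ, ContMDiff I 𝓘(ℝ, ℝ) ∞ ρ ∧ (∀ (g : G) x, ρ (g • x) = ρ x) ∧ (∀ x, 0 ≤ ρ x) ∧
      ∀ c, IsCompact {x | ρ x ≤ c} := by
  have : IsTopologicalGroup G := topologicalGroup_of_lieGroup IG ∞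
  have : ContinuousSMul G N := ContMDiffSMul.continuousSMul (I := IG) (I' := I) ∞
  borelize G
  obtain ⟨μ, hμ, hμ'⟩ := exists_isMulRightInvariant_probabilityMeasure G
  obtain ⟨f, hf, hf0, hfc⟩ := exists_contMDiff_isCompact_sublevel I N
  have hs := contMDiff_average IG μ hf
  refine ⟨_, hs, fun g x => average_smul μ f g x, fun x => integral_nonneg fun g => hf0 _,
    fun c => ?_⟩
  refine (isCompact_setOf_exists_smul_mem (G := G) (hfc c)).of_isClosed_subset
    (isClosed_le hs.continuous continuous_const) fun x hx => ?_
  by_contra! h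
  have hcont : Continuous fun g : G => f (g • x) :=
    hf.continuous.comp (continuous_id.smul continuous_const)
  have h1 : 0 < ∫ g : G, (f (g • x) - c) ∂μ :=
    integral_pos_of_continuous μ (hcont.sub continuous_const) fun g => by
      have : ¬ f (g • x) ≤ c := fun h' => h ⟨g, h'⟩
      linarith [not_le.1 this]
  rw [integral_sub (integrable_of_continuous μ hcont) (integrable_const c)] at h1
  simp only [integral_const, probReal_univ, one_smul] at h1
  have hx' : ∫ g : G, f (g • x) ∂μ ≤ c := hx
  linarith

include IG in
/-- An invariant smooth cutoff function for a closed invariant set in an invariant open set. -/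
lemma exists_invariant_cutoff {Y W : Set N} (hY : IsClosed Y) (hYinv : IsInvariantSet G Y)
    (hW : IsOpen W) (hWinv : IsInvariantSet G W) (hYW : Y ⊆ W) :
    ∃ (χ : N → ℝ) (U : Set N), ContMDiff I 𝓘(ℝ, ℝ) ∞ χ ∧ (∀ (g : G) x, χ (g • x) = χ x) ∧
      (∀ x, χ x ∈ Icc (0 : ℝ) 1) ∧ (∀ x ∉ W, χ x = 0) ∧ IsOpen U ∧ IsInvariantSet G U ∧ Y ⊆ U ∧
      ∀ x ∈ U, χ x = 1 := by
  have : IsTopologicalGroup G := topologicalGroup_of_lieGroup IG ∞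
  have : ContinuousSMul G N := ContMDiffSMul.continuousSMul (I := IG) (I' := I) ∞
  have : LocallyCompactSpace N := Manifold.locallyCompact_of_finiteDimensional I
  borelize G
  obtain ⟨μ, hμ, hμ'⟩ := exists_isMulRightInvariant_probabilityMeasure G
  obtain ⟨U₀, hU₀, hYU₀, hU₀W⟩ := normal_exists_closure_subset hY hW hYW
  obtain ⟨χ, hχ0, hχ1, hχ⟩ := exists_contMDiffMap_zero_one_of_isClosed (n := ⊤) I
    hW.isClosed_compl (isClosed_closure (s := U₀))
    (disjoint_compl_left_iff_subset.2 hU₀W)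
  have hcont : ∀ x, Continuous fun g : G => χ (g • x) := fun x =>
    χ.contMDiff.continuous.comp (continuous_id.smul continuous_const)
  refine ⟨fun x => ∫ g : G, χ (g • x) ∂μ, {x | ∀ g : G, g • x ∈ U₀},
    contMDiff_average IG μ χ.contMDiff, average_smul μ χ,
    fun x => ⟨integral_nonneg fun g => (hχ _).1, ?_⟩, fun x hx => ?_,
    isOpen_setOf_forall_smul_mem hU₀, fun g x hx h => ?_, fun y hy g => hYU₀ (hYinv g y hy),
    fun x hx => ?_⟩
  · have := integral_mono (integrable_of_continuous μ (hcont x)) (integrable_const (1 : ℝ))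
      fun g => (hχ (g • x)).2
    simpa using this
  · have : ∀ g : G, χ (g • x) = 0 := fun g => hχ0 fun h => hx <| by
      simpa using hWinv g⁻¹ _ h
    simp [this]
  · rw [smul_smul]
    exact hx _
  · have : ∀ g : G, χ (g • x) = 1 := fun g => hχ1 (subset_closure (hx g))
    simp [this]

include IG in
/-- An invariant function that is proper and bounded below on a closed invariant set `Y` agrees
near `Y` with one that is proper and bounded below everywhere. -/
theorem exists_proper_extension {f : N → ℝ} (hf : ContMDiff I 𝓘(ℝ, ℝ) ∞ f)
    (hfinv : ∀ (g : G) x, f (g • x) = f x) {Y : Set N} (hY : IsClosed Y)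
    (hYinv : IsInvariantSet G Y) (hprop : IsProperMap fun y : Y => f y)
    (hbdd : BddBelow (range fun y : Y => f y)) :
    ∃ (ψ : N → ℝ) (U : Set N), ContMDiff I 𝓘(ℝ, ℝ) ∞ ψ ∧ (∀ (g : G) x, ψ (g • x) = ψ x) ∧
      IsProperMap ψ ∧ BddBelow (range ψ) ∧ IsOpen U ∧ IsInvariantSet G U ∧ Y ⊆ U ∧
      ∀ x ∈ U, ψ x = f x := by
  obtain ⟨ρ, hρ, hρinv, hρ0, hρc⟩ := exists_invariant_isCompact_sublevel I N IG G
  obtain ⟨b, hb⟩ := hbdd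
  have hb' : ∀ y ∈ Y, b ≤ f y := fun y hy => hb ⟨⟨y, hy⟩, rfl⟩
  have hM : ∀ n : ℕ, ∃ M : ℝ, n ≤ M ∧ ∀ y ∈ Y, f y ≤ n → ρ y < M := by
    intro n
    have hK := (hprop.isCompact_preimage (isCompact_Icc (a := b) (b := (n : ℝ)))).bddAbove_image
      (f := fun y : Y => ρ y) (hρ.continuous.comp continuous_subtype_val).continuousOn
    obtain ⟨C, hC⟩ := hK
    refine ⟨max n (C + 1), le_max_left _ _, fun y hy hyn => ?_⟩
    have : ρ y ≤ C := hC ⟨⟨y, hy⟩, ⟨hb' y hy, hyn⟩, rfl⟩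
    exact lt_of_lt_of_le (by linarith) (le_max_right _ _)
  choose M hnM hM using hM
  let W : Set N := {x | b - 1 < f x ∧ ∀ n : ℕ, f x ≤ n → ρ x < M n}
  have hW : IsOpen W := by
    rw [isOpen_iff_mem_nhds]
    rintro x ⟨hx1, hx2⟩
    obtain ⟨k, hk⟩ := exists_nat_gt (ρ x)
    have e1 : ∀ᶠ y in 𝓝 x, b - 1 < f y := hf.continuous.continuousAt.eventually_const_lt hx1
    have e2 : ∀ᶠ y in 𝓝 x, ρ y < k := hρ.continuous.continuousAt.eventually_lt_const hk
    have e3 : ∀ᶠ y in 𝓝 x, ∀ n ∈ Finset.range k, f y ≤ n → ρ y < M n := by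
      rw [Filter.eventually_all_finset]
      intro n _
      by_cases hn : f x ≤ n
      · filter_upwards [hρ.continuous.continuousAt.eventually_lt_const (hx2 n hn)] with y hy _
        exact hy
      · filter_upwards [hf.continuous.continuousAt.eventually_const_lt (not_le.1 hn)]
          with y hy h
        exact absurd h (not_le.2 hy)
    filter_upwards [e1, e2, e3] with y h1 h2 h3
    refine ⟨h1, fun n hn => ?_⟩
    by_cases hnk : n < k
    · exact h3 n (Finset.mem_range.2 hnk) hn
    · have : (k : ℝ) ≤ n := by exact_mod_cast not_lt.1 hnk
      exact h2.trans_le (this.trans (hnM n))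
  have hWinv : IsInvariantSet G W := fun g x hx => by
    change b - 1 < f (g • x) ∧ ∀ n : ℕ, f (g • x) ≤ n → ρ (g • x) < M n
    rw [hfinv, hρinv]
    exact hx
  have hYW : Y ⊆ W := fun y hy => ⟨by linarith [hb' y hy], fun n hn => hM n y hy hn⟩
  obtain ⟨χ, U, hχ, hχinv, hχI, hχW, hU, hUinv, hYU, hχU⟩ :=
    exists_invariant_cutoff (I := I) IG hY hYinv hW hWinv hYW
  have hψ : ContMDiff I 𝓘(ℝ, ℝ) ∞ fun x => χ x * f x + (1 - χ x) * ρ x :=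
    (hχ.mul hf).add ((contMDiff_const.sub hχ).mul hρ)
  refine ⟨fun x => χ x * f x + (1 - χ x) * ρ x, U, hψ, fun g x => ?_, ?_, ?_, hU, hUinv, hYU,
    fun x hx => ?_⟩
  · simp only [hfinv, hρinv, hχinv]
  · rw [isProperMap_iff_isCompact_preimage]
    refine ⟨hψ.continuous, fun k hk => ?_⟩
    obtain ⟨c, hc⟩ := hk.bddAbove
    obtain ⟨n, hn⟩ := exists_nat_ge c
    refine (hρc (max c (M n))).of_isClosed_subset (hk.isClosed.preimage hψ.continuous)
      fun x hx => ?_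
    have hx' : χ x * f x + (1 - χ x) * ρ x ≤ c := hc hx
    change ρ x ≤ max c (M n)
    by_cases hxW : x ∈ W
    · by_cases hfn : f x ≤ n
      · exact (hxW.2 n hfn).le.trans (le_max_right _ _)
      · refine le_trans ?_ (le_max_left _ _)
        by_contra! hlt
        have h1 : c < f x := hn.trans_lt (not_le.1 hfn)
        obtain ⟨h2, h3⟩ := hχI x
        exact hx'.not_gt (convex_Ioi c h1 hlt h2 (sub_nonneg.2 h3) (add_sub_cancel _ _))
    · rw [hχW x hxW] at hx'
      exact le_trans (by linarith) (le_max_left _ _)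
  · refine ⟨min (b - 1) 0, ?_⟩
    rintro _ ⟨x, rfl⟩
    change min (b - 1) 0 ≤ χ x * f x + (1 - χ x) * ρ x
    by_cases hxW : x ∈ W
    · obtain ⟨h2, h3⟩ := hχI x
      have h4 : min (b - 1) 0 ≤ f x := (min_le_left _ _).trans hxW.1.le
      have h5 : min (b - 1) 0 ≤ ρ x := (min_le_right _ _).trans (hρ0 x)
      nlinarith [mul_nonneg h2 (sub_nonneg.2 h4),
        mul_nonneg (sub_nonneg.2 h3) (sub_nonneg.2 h5)]
    · rw [hχW x hxW]
      exact (min_le_right _ _).trans (by linarith [hρ0 x])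
  · simp [hχU x hx]

end Proper

end HamiltonianCompletion

end

noncomputable section

namespace HamiltonianCompletion

open Bundle

/-! ### Modifying a momentum map by an invariant `1`-form -/

section Modification

variable {EG : Type*} [NormedAddCommGroup EG] [NormedSpace ℝ EG]
  {HG : Type*} [TopologicalSpace HG] {IG : ModelWithCorners ℝ EG HG}
  {G : Type*} [TopologicalSpace G] [ChartedSpace HG G] [Group G] [LieGroup IG ∞ G]
  {E : Type*} [NormedAddCommGroup E] [NormedSpace ℝ E]
  {H : Type*} [TopologicalSpace H] {I : ModelWithCorners ℝ E H}
  {N : Type*} [TopologicalSpace N] [ChartedSpace H N]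
  [MulAction G N]

variable (IG) in
/-- The momentum map `Φ + β(X^♯)`. -/
def modifiedMomentumMap (Φ : N → (GroupLieAlgebra IG G →L[ℝ] ℝ))
    (β : (x : N) → TangentSpace I x →L[ℝ] ℝ) (x : N) : GroupLieAlgebra IG G →L[ℝ] ℝ :=
  let Φx : EG →L[ℝ] ℝ := Φ x
  let βx : E →L[ℝ] ℝ := β x
  let D : EG →L[ℝ] E := mfderiv IG I (fun g : G => g • x) 1
  Φx + βx.comp D

omit [LieGroup IG ∞ G] in
lemma modifiedMomentumMap_apply (Φ : N → (GroupLieAlgebra IG G →L[ℝ] ℝ))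
    (β : (x : N) → TangentSpace I x →L[ℝ] ℝ) (x : N) (X : GroupLieAlgebra IG G) :
    modifiedMomentumMap IG Φ β x X = Φ x X + β x (fundamentalField IG I X x) :=
  rfl

omit [TopologicalSpace G] [ChartedSpace HG G] [LieGroup IG ∞ G] in
lemma isInvariantForm_oneForm {β : (x : N) → TangentSpace I x →L[ℝ] ℝ}
    (h : ∀ (g : G) (x : N) (u : TangentSpace I x),
      β (g • x) (mfderiv I I (fun y : N => g • y) x u) = β x u) :
    IsInvariantForm I G (oneForm I β) := by
  intro g x
  ext u
  exact h g x (u 0)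

variable [IsManifold I ∞ N] [ContMDiffSMul IG I ∞ G N]

lemma IsHamiltonian.sub_exteriorDerivative [IG.Boundaryless]
    {σ : (x : N) → TangentSpace I x [⋀^Fin 2]→L[ℝ] ℝ}
    {Φ : N → (GroupLieAlgebra IG G →L[ℝ] ℝ)} (hσ : IsHamiltonian IG I σ Φ)
    {β : (x : N) → TangentSpace I x →L[ℝ] ℝ} (hβ : IsSmoothForm I (oneForm I β))
    (hinv : ∀ (g : G) (x : N) (u : TangentSpace I x),
      β (g • x) (mfderiv I I (fun y : N => g • y) x u) = β x u)
    (hβX : ∀ X : GroupLieAlgebra IG G,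
      ContMDiff I 𝓘(ℝ, ℝ) ∞ fun x => β x (fundamentalField IG I X x)) :
    IsHamiltonian IG I (fun x => σ x - exteriorDerivative I (oneForm I β) x)
      (modifiedMomentumMap IG Φ β) where
  smooth_form := hσ.smooth_form.sub hβ.isSmoothForm_exteriorDerivative
  invariant g x := by
    have h := (isInvariantForm_oneForm hinv).exteriorDerivative IG hβ g x
    have h' := hσ.invariant g x
    ext u
    have e := congrArg (fun L : TangentSpace I x [⋀^Fin 2]→L[ℝ] ℝ => L u) h
    have e' := congrArg (fun L : TangentSpace I x [⋀^Fin 2]→L[ℝ] ℝ => L u) h'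
    exact congrArg₂ (· - ·) e' e
  closed x := by
    rw [hσ.smooth_form.exteriorDerivative_sub hβ.isSmoothForm_exteriorDerivative, hσ.closed,
      hβ.exteriorDerivative_exteriorDerivative, sub_zero]
  smooth_map X := (hσ.smooth_map X).add (hβX X)
  equivariant g x X := by
    rw [modifiedMomentumMap_apply, modifiedMomentumMap_apply, hσ.equivariant]
    refine congrArg₂ (· + ·) rfl ?_
    rw [← hinv g x, ← fundamentalField_adjoint, adjoint_adjoint_inv]
  hamilton X x u := by
    have h1 := ((hσ.smooth_map X).mdifferentiable (by simp) x)
    have h2 := ((hβX X).mdifferentiable (by simp) x)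
    have h3 := exteriorDerivative_oneForm_fundamentalField IG hβ
      (isInvariantForm_oneForm hinv) X x u
    have h4 := congrArg (fun L : E →L[ℝ] ℝ => L u) (mfderiv_add h1 h2)
    refine h4.trans ?_
    have key : ∀ a b c d : ℝ, a = c → d = -b → a + b = c - d := fun a b c d h h' => by
      rw [h, h', sub_neg_eq_add]
    exact key _ _ _ _ (hσ.hamilton X x u) h3

end Modification

end HamiltonianCompletion

end

open HamiltonianCompletion in
theorem mainTheorem3
    -- a compact Lie group
    {EG : Type*} [NormedAddCommGroup EG] [NormedSpace ℝ EG] [FiniteDimensional ℝ EG]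
    {HG : Type*} [TopologicalSpace HG] (IG : ModelWithCorners ℝ EG HG) [IG.Boundaryless]
    {G : Type*} [TopologicalSpace G] [ChartedSpace HG G] [Group G] [LieGroup IG ∞ G]
    [CompactSpace G] [T2Space G]
    -- a manifold, possibly with boundary, with a smooth action
    {E : Type*} [NormedAddCommGroup E] [NormedSpace ℝ E] [FiniteDimensional ℝ E]
    {H : Type*} [TopologicalSpace H] (I : ModelWithCorners ℝ E H)
    {N : Type*} [TopologicalSpace N] [ChartedSpace H N] [IsManifold I ∞ N]
    [T2Space N] [SecondCountableTopology N]
    [MulAction G N] [ContMDiffSMul IG I ∞ G N]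
    (v : N → GroupLieAlgebra IG G) (hv : IsTamingMap IG I v)
    (Y : Set N) (hYclosed : IsClosed Y) (hYinv : IsInvariantSet G Y)
    (hZY : localizingSet IG I v ⊆ Y)
    (σ : (x : N) → TangentSpace I x [⋀^Fin 2]→L[ℝ] ℝ)
    (Φ : N → (GroupLieAlgebra IG G →L[ℝ] ℝ)) (hσ : IsHamiltonian IG I σ Φ)
    (hpol : IsPolarizedOn IG v Φ Y) :
    ∃ (σ' : (x : N) → TangentSpace I x [⋀^Fin 2]→L[ℝ] ℝ)
      (Φ' : N → (GroupLieAlgebra IG G →L[ℝ] ℝ)) (U : Set N),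
      IsHamiltonian IG I σ' Φ' ∧
      (IsOpen U ∧ IsInvariantSet G U ∧ Y ⊆ U ∧ ∀ x ∈ U, σ' x = σ x ∧ Φ' x = Φ x) ∧
      IsPolarizedOn IG v Φ' univ ∧
      -- the pair is built from a proper invariant function `ψ` and a Bott projector
      ∃ (ψ : N → ℝ)
        (m : Bundle.ContMDiffRiemannianMetric I ∞ E (TangentSpace I : N → Type _)),
        ContMDiff I 𝓘(ℝ, ℝ) ∞ ψ ∧ (∀ (g : G) (x : N), ψ (g • x) = ψ x) ∧
        IsProperMap ψ ∧ BddBelow (range ψ) ∧ (∀ x ∈ U, ψ x = Φ x (v x)) ∧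
        IsInvariantMetric I G m ∧
        (∀ x, σ' x = σ x - exteriorDerivative I (oneForm I fun y =>
          (ψ y - Φ y (v y)) • bottProjector I m (tamingField IG I v) y) x) ∧
        (∀ (x : N) (X : GroupLieAlgebra IG G), Φ' x X = Φ x X +
          (ψ x - Φ x (v x)) *
            bottProjector I m (tamingField IG I v) x (fundamentalField IG I X x)) := by
  have hlc : LocallyCompactSpace N := Manifold.locallyCompact_of_finiteDimensional I
  obtain ⟨hprop, hbdd⟩ := hpol
  have hf := hσ.contMDiff_apply_tamingMap hv
  obtain ⟨ψ, U, hψ, hψinv, hψprop, hψbdd, hU, hUinv, hYU, hψU⟩ :=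
    exists_proper_extension IG hf (hσ.apply_tamingMap_smul hv) hYclosed hYinv hprop hbdd
  obtain ⟨m, hm⟩ := exists_isInvariantMetric IG G I N
  let V : (x : N) → TangentSpace I x := tamingField IG I v
  let h : N → ℝ := fun x => ψ x - Φ x (v x)
  let β : (x : N) → TangentSpace I x →L[ℝ] ℝ := fun x => h x • bottProjector I m V x
  have hV : ContMDiff I (I.prod 𝓘(ℝ, E)) ∞ fun x => Bundle.TotalSpace.mk' E x (V x) :=
    contMDiff_fundamentalField IG hv.smooth
  have hh : ContMDiff I 𝓘(ℝ, ℝ) ∞ h := hψ.sub hf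
  have hhU : ∀ x ∈ U, h x = 0 := fun x hx => sub_eq_zero.2 (hψU x hx)
  have hZU : ∀ x, V x = 0 → x ∈ U := fun x hx => hYU (hZY hx)
  have hz : ∀ x, V x = 0 → h =ᶠ[𝓝 x] 0 := fun x hx =>
    Filter.eventually_of_mem (hU.mem_nhds (hZU x hx)) hhU
  have hβ : IsSmoothForm I (oneForm I β) := isSmoothForm_oneForm fun x₀ x hx a =>
    contMDiffAt_smul_bottProjector_apply hV hh hz (contMDiffAt_coordField x₀ a hx)
  have hβX : ∀ X : GroupLieAlgebra IG G,
      ContMDiff I 𝓘(ℝ, ℝ) ∞ fun x => β x (fundamentalField IG I X x) := fun X x =>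
    contMDiffAt_smul_bottProjector_apply hV hh hz
      (contMDiff_fundamentalField IG (w := fun _ => X)
        (contMDiff_const (M' := EG) (c := (X : EG))) x)
  have hhinv : ∀ (g : G) x, h (g • x) = h x := fun g x =>
    congrArg₂ (· - ·) (hψinv g x) (hσ.apply_tamingMap_smul hv g x)
  have hinv : ∀ (g : G) (x : N) (u : TangentSpace I x),
      β (g • x) (mfderiv I I (fun y : N => g • y) x u) = β x u := fun g x u =>
    congrArg₂ (· * ·) (hhinv g x) (bottProjector_smul hm (hv.tamingField_smul g x) u)
  have hβU : ∀ x ∈ U, β x = 0 := fun x hx => by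
    change h x • bottProjector I m V x = 0
    rw [hhU x hx, zero_smul]
  have happ : ∀ x (X : GroupLieAlgebra IG G), modifiedMomentumMap IG Φ β x X =
      Φ x X + h x * bottProjector I m V x (fundamentalField IG I X x) := fun x X => rfl
  have hΦv : ∀ x, modifiedMomentumMap IG Φ β x (v x) = ψ x := fun x => by
    rw [happ]
    by_cases hx : V x = 0
    · rw [hhU x (hZU x hx), zero_mul, add_zero, hψU x (hZU x hx)]
    · rw [show bottProjector I m V x (fundamentalField IG I (v x) x) = 1 from
        bottProjector_self hx, mul_one]
      exact add_sub_cancel _ _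
  refine ⟨fun x => σ x - exteriorDerivative I (oneForm I β) x, modifiedMomentumMap IG Φ β, U,
    hσ.sub_exteriorDerivative hβ hinv hβX, ⟨hU, hUinv, hYU, fun x hx => ?_⟩, ?_,
    ψ, m, hψ, hψinv, hψprop, hψbdd, hψU, hm, fun x => rfl, happ⟩
  · refine ⟨?_, ContinuousLinearMap.ext fun X => ?_⟩
    · have h0 : exteriorDerivative I (oneForm I β) x = 0 := by
        refine exteriorDerivative_eq_zero_of_eventually ?_
        filter_upwards [hU.mem_nhds hx] with y hy
        ext u
        exact congrArg (fun L : TangentSpace I y →L[ℝ] ℝ => L (u 0)) (hβU y hy)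
      change σ x - exteriorDerivative I (oneForm I β) x = σ x
      rw [h0, sub_zero]
    · rw [modifiedMomentumMap_apply, hβU x hx]
      exact add_zero _
  · refine ⟨?_, ?_⟩
    · simp only [hΦv]
      exact hψprop.comp (Homeomorph.Set.univ N).isProperMap
    · simp only [hΦv]
      exact hψbdd.mono (range_subset_iff.2 fun y => mem_range_self y.1)
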